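/- Let $0<\rho<1$. Consider an $M/M/1$ processor-sharing queue with arrival rate $\rho$ and unit service rate, which a tagged customer enters at time $0$ in the stationary regime. Let $N_0$ be the number of customers it finds in the queue and let $N_k$ be the number of customers other than the tagged one just after the $k$-th subsequent event (arrival or departure), with $N_k=-1$ once the tagged customer has completed its service. Thus $(N_k)_{k\ge 0}$ is a Markov chain on $\{-1,0,1,2,\dots\}$ for which $-1$ is absorbing and, for $n\ge 0$, $$P(n,-1)=\frac{1}{(n+1)(1+\rho)},\qquad P(n,n-1)=\frac{n}{(n+1)(1+\rho)}\ (n\ge 1),\qquad P(n,n+1)=\frac{\rho}{1+\rho},$$ and the law of $N_0$ is the stationary distribution of the number of customers in the $M/M/1$ queue, i.e. the probability distribution $(p_n)_{n\ge 0}$ with $\rho p_0=p_1$ and $(1+\rho)p_{n+1}=\rho p_n+p_{n+2}$ for $n\ge 0$. Let $\alpha$ and $\delta$ be the numbers of arrivals (upward steps of $(N_k)$) and of departures other than that of the tagged customer (downward steps of $(N_k)$ that do not correspond to the tagged customer's own departure, i.e. steps from $n+1$ to $n$ with $n\ge 0$) while the tagged customer is in the system. Define polynomials $P_n$ by $P_0(x)=1$,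 $P_1(x)=2x$ and $(n+1)P_{n+1}(x)-(2n+2)\,x\,P_n(x)+nP_{n-1}(x)=0$ for $n\ge 1$ (the Pollaczek polynomials $P_n(x;1,0)$), and put $$Q_n(x)=\rho^{-n/2}\,P_n\!\left(\frac{1+\rho}{2\sqrt\rho}\,x\right).$$ Let $\psi$ be the orthogonality measure of the $Q_n$: it is carried by $\left[-\frac{2\sqrt\rho}{1+\rho},\frac{2\sqrt\rho}{1+\rho}\right]$, with density $$\frac{d\psi}{dx}(x)=\frac{1+\rho}{\sqrt\rho}\,w\!\left(\frac{1+\rho}{2\sqrt\rho}\,x\right),\qquad w(\cos\theta)=\frac{e^{(2\theta-\pi)\tau}}{2\cosh(\pi\tau)},\quad \tau=\frac{\cos\theta}{2\sin\theta},\quad 0<\theta<\pi .$$ Then $\alpha$ is almost surely finite, the integrals below converge absolutely, and for every integer $j\ge 0$ $$\mathbb P(\alpha=j)=\frac{1-\rho}{1+\rho}\sum_{n=0}^{\infty}\sum_{m=0}^{j+n}\rho^{m+n}\int_{-\frac{2\sqrt\rho}{1+\rho}}^{\frac{2\sqrt\rho}{1+\rho}}x^{2j+n-m}\,Q_m(x)\,Q_n(x)\,d\psi(x),$$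 the series over $n$ (of the finite inner sums) being convergent. Moreover $\delta$ has the same distribution as $\alpha$. -/

import Mathlib

open MeasureTheory ProbabilityTheory

namespace PSQueue

noncomputable section

/-- State of the embedded chain of the `M/M/1` processor sharing queue during the sojourn of the
tagged customer: `some n` means that the tagged customer is in the queue together with `n` other
customers; `none` is the absorbing state (written `-1` on paper), entered when the tagged customer
completes its service. -/
abbrev State : Type := Option ℕ

/-- Transition probabilities of the embedded chain, for arrival rate `ρ` and unit service rate.
With `n` other customers, the next event is an arrival (rate `ρ`), the departure of one of the `n`
other customers (each served at rate `1 / (n + 1)`), or the departure of the tagged customer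
(rate `1 / (n + 1)`). -/
def transition (ρ : ℝ) : State → State → ℝ
  | none, none => 1
  | none, some _ => 0
  | some n, none => 1 / (((n : ℝ) + 1) * (1 + ρ))
  | some n, some m =>
      if m = n + 1 then ρ / (1 + ρ)
      else if n = m + 1 then (n : ℝ) / (((n : ℝ) + 1) * (1 + ρ))
      else 0

/-- `N` is a (time-homogeneous) Markov chain on the countable state space `S` with transition
matrix `P`. The elementary Markov property is written multiplicatively, so that no conditioning on
null events occurs. -/
structure IsMarkovChain {Ω S : Type*} [MeasurableSpace Ω] (μ : Measure Ω)
    (P : S → S → ℝ) (N : ℕ → Ω → S) : Prop where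
  measurableSet_eq : ∀ (k : ℕ) (s : S), MeasurableSet {ω | N k ω = s}
  markov : ∀ (k : ℕ) (s : ℕ → S),
    μ.real {ω | ∀ i ≤ k + 1, N i ω = s i}
      = μ.real {ω | ∀ i ≤ k, N i ω = s i} * P (s k) (s (k + 1))

/-- `p` is a stationary distribution of the number of customers in the `M/M/1` queue with arrival
rate `ρ` and unit service rate: a probability distribution on `ℕ` which satisfies the global
balance equations. -/
structure IsStationaryQueueLength (ρ : ℝ) (p : ℕ → ℝ) : Prop where
  nonneg : ∀ n, 0 ≤ p n
  hasSum_one : HasSum p 1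
  balance_zero : ρ * p 0 = p 1
  balance_succ : ∀ n, (1 + ρ) * p (n + 1) = ρ * p n + p (n + 2)

/-- Number of arrivals, on the trajectory `x`, while the tagged customer is in the system. -/
def arrivals (x : ℕ → State) : ℕ∞ :=
  {k : ℕ | (∀ i ≤ k, x i ≠ none) ∧ ∃ n : ℕ, x k = some n ∧ x (k + 1) = some (n + 1)}.encard

/-- Number of departures (other than that of the tagged customer), on the trajectory `x`, while the
tagged customer is in the system. -/
def departures (x : ℕ → State) : ℕ∞ :=
  {k : ℕ | (∀ i ≤ k, x i ≠ none) ∧ ∃ n : ℕ, x k = some (n + 1) ∧ x (k + 1) = some n}.encard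

/-- The Pollaczek polynomials `P_n(x; a, b)`: `P_{-1} = 0`, `P_0 = 1` and
`(n + 1) P_{n+1} - ((2 n + 1 + a) x + b) P_n + n P_{n-1} = 0`. -/
def pollaczek (a b : ℝ) : ℕ → ℝ → ℝ
  | 0, _ => 1
  | 1, x => (1 + a) * x + b
  | n + 2, x =>
      (((2 * ((n : ℝ) + 1) + 1 + a) * x + b) * pollaczek a b (n + 1) x
        - ((n : ℝ) + 1) * pollaczek a b n x) / ((n : ℝ) + 2)

/-- The weight function `w(x; a, b)` of the Pollaczek polynomials on `[-1, 1]`, with `x = cos θ`,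
`θ ∈ [0, π]` and `τ = (a cos θ + b) / (2 sin θ)`. -/
def pollaczekWeight (a b x : ℝ) : ℝ :=
  let θ := Real.arccos x
  let τ := (a * Real.cos θ + b) / (2 * Real.sin θ)
  Real.exp ((2 * θ - Real.pi) * τ) / (2 * Real.cosh (Real.pi * τ))

/-- The rescaled polynomials `Q_n(x) = ρ^{-n/2} P_n((1 + ρ) x / (2 √ρ); 1, 0)`. -/
def Q (ρ : ℝ) (n : ℕ) (x : ℝ) : ℝ :=
  1 / Real.sqrt ρ ^ n * pollaczek 1 0 n ((1 + ρ) / (2 * Real.sqrt ρ) * x)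

/-- The end point `2 √ρ / (1 + ρ)` of the spectrum. -/
def edge (ρ : ℝ) : ℝ := 2 * Real.sqrt ρ / (1 + ρ)

/-- The orthogonality measure `ψ` of the polynomials `Q_n`: it is carried by
`[-2√ρ/(1+ρ), 2√ρ/(1+ρ)]` and has there the density
`(1 + ρ)/√ρ * w((1 + ρ) x / (2 √ρ); 1, 0)`. -/
def psi (ρ : ℝ) : Measure ℝ :=
  (volume.restrict (Set.Icc (-edge ρ) (edge ρ))).withDensity fun x =>
    ENNReal.ofReal ((1 + ρ) / Real.sqrt ρ
      * pollaczekWeight 1 0 ((1 + ρ) / (2 * Real.sqrt ρ) * x))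

end

end PSQueue

/-!
The law of the number `α` of arrivals is computed from a spectral representation of the chain killed
when the tagged customer leaves.

**Probability.** A trajectory which finds `n` customers, leaves `m` behind and lasts `k + 1`
events has `a` arrivals and `d` departures of others with `a + d = k` and `n + a = m + d`, so that
the event `α = j` is, up to a null set, the disjoint union over `(n, m)` of the events `exit N k n
m` with `k = 2 j + n - m` (`measure_arrivals_eq`). The sojourn is almost surely finite, since
after `k` events at most `n + k` other customers are present and the survival probability is
`O(k^{-1/2})` (`sq_measureReal_survival_le`). The killed chain has the `Q_n` as generalized
eigenvectors: `mul_Q` is its transition matrix. Together with orthogonality of the `Q_n` this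
gives `P(exit N k n m) = (1 - ρ) / (1 + ρ) * ρ ^ (m + n) * ∫ x ^ k Q_m Q_n dψ`
(`measureReal_exit_eq`), which is summed to the law of `α`; the symmetry in `m` and `n` shows that
the number `δ` of other departures has the same law (`measure_arrivals_eq_departures`).

**Orthogonality.** By the three-term recurrence it is enough that the Pollaczek polynomials of
positive degree have mean zero for the weight `w`, of total mass `1/2`
(`integral_pollaczek_mul_weight`). With `K_n(θ, u) = e^{-iu cot θ} sinh(u)^n / sinh(u - iθ)^{n +
1}` one has `∫_ℝ K_n(θ, u) du = 2πi P_n(cos θ) w(cos θ)`: the recurrence holds because its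
combination of the kernels is a derivative in `u` (`hasDerivAt_kernel`), and for `n = 0` the line
of integration can be moved to `θ = π/2`, where the integral is the Fourier transform of `1 /
cosh` (`integral_kernel_zero`). On the other hand, for fixed `u > 0`, the function `sin θ K_n(θ,
u)` is the boundary value at `z = e^{iθ}` of a function which is analytic in the unit disc and
vanishes at `0` to order `n`, so its integral over the circle vanishes for `n > 0`
(`integral_circle_kernel`). Since `sin θ K_n(θ, u)` is invariant under `(θ, u) ↦ (-θ, -u)`, the
integral over the circle and `u > 0` equals the one over `0 < θ < π` and `u ∈ ℝ`, and Fubini's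
theorem concludes.
-/

namespace PSQueue

/-! ### Hyperbolic estimates -/

theorem integrable_inv_cosh : Integrable (fun u : ℝ => (Real.cosh u)⁻¹) := by
  refine (integrable_inv_one_add_sq.const_mul 4).mono'
    (Real.continuous_cosh.inv₀ fun u => (Real.cosh_pos u).ne').aestronglyMeasurable
    (Filter.Eventually.of_forall fun u => ?_)
  rw [Real.norm_of_nonneg (inv_nonneg.2 (Real.cosh_pos u).le), ← div_eq_mul_inv,
    inv_eq_one_div, div_le_div_iff₀ (Real.cosh_pos u) (by positivity)]
  have h1 := Real.quadratic_le_exp_of_nonneg (abs_nonneg u)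
  have h2 := Real.cosh_eq |u|
  rw [Real.cosh_abs] at h2
  nlinarith [Real.exp_pos (-|u|), sq_abs u, abs_nonneg u]

/-- `sinh (u - iθ)` for real `u` and `θ`. -/
noncomputable def shiftedSinh (θ u : ℝ) : ℂ := Complex.sinh (u - θ * Complex.I)

theorem shiftedSinh_eq (θ u : ℝ) : shiftedSinh θ u
    = ((Real.sinh u * Real.cos θ : ℝ) : ℂ) - ((Real.cosh u * Real.sin θ : ℝ) : ℂ) * Complex.I := by
  rw [shiftedSinh, Complex.sinh_sub, Complex.cosh_mul_I, Complex.sinh_mul_I]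
  push_cast
  ring

theorem norm_shiftedSinh_sq (θ u : ℝ) :
    ‖shiftedSinh θ u‖ ^ 2 = Real.sinh u ^ 2 + Real.sin θ ^ 2 := by
  rw [shiftedSinh_eq, Complex.sq_norm, Complex.normSq_apply]
  simp only [Complex.sub_re, Complex.ofReal_re, Complex.mul_re, Complex.I_re, Complex.ofReal_im,
    Complex.I_im, Complex.sub_im, Complex.mul_im]
  have h1 := Real.cosh_sq u
  have h2 := Real.cos_sq' θ
  ring_nf
  rw [h1, h2]
  ring

theorem abs_sin_mul_cosh_le_norm_shiftedSinh (θ u : ℝ) :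
    |Real.sin θ| * Real.cosh u ≤ ‖shiftedSinh θ u‖ := by
  refine abs_le_of_sq_le_sq' ?_ (norm_nonneg _) |>.2
  rw [norm_shiftedSinh_sq, mul_pow, sq_abs, Real.cosh_sq]
  nlinarith [Real.sin_sq_le_one θ, sq_nonneg (Real.sinh u)]

theorem abs_sinh_le_norm_shiftedSinh (θ u : ℝ) : |Real.sinh u| ≤ ‖shiftedSinh θ u‖ := by
  refine abs_le_of_sq_le_sq' ?_ (norm_nonneg _) |>.2
  rw [norm_shiftedSinh_sq, sq_abs]
  nlinarith [sq_nonneg (Real.sin θ)]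

theorem norm_cosh_sub_mul_I_le (θ u : ℝ) :
    ‖Complex.cosh (u - θ * Complex.I)‖ ≤ Real.cosh u := by
  refine abs_le_of_sq_le_sq' ?_ (Real.cosh_pos u).le |>.2
  have : Complex.cosh (u - θ * Complex.I) = ((Real.cosh u * Real.cos θ : ℝ) : ℂ)
      - ((Real.sinh u * Real.sin θ : ℝ) : ℂ) * Complex.I := by
    rw [Complex.cosh_sub, Complex.cosh_mul_I, Complex.sinh_mul_I]
    push_cast
    ring
  rw [this, Complex.sq_norm, Complex.normSq_apply]
  simp only [Complex.sub_re, Complex.ofReal_re, Complex.mul_re, Complex.I_re, Complex.ofReal_im,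
    Complex.I_im, Complex.sub_im, Complex.mul_im]
  have h1 := Real.cosh_sq u
  nlinarith [Real.sin_sq_add_cos_sq θ, sq_nonneg (Real.sinh u), sq_nonneg (Real.sin θ),
    mul_nonneg (sq_nonneg (Real.sinh u)) (sq_nonneg (Real.sin θ)), sq_nonneg (Real.cos θ)]

theorem shiftedSinh_ne_zero {θ : ℝ} (hθ : Real.sin θ ≠ 0) (u : ℝ) : shiftedSinh θ u ≠ 0 := by
  rw [← norm_pos_iff]
  exact (mul_pos (abs_pos.2 hθ) (Real.cosh_pos u)).trans_le
    (abs_sin_mul_cosh_le_norm_shiftedSinh θ u)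

theorem hasDerivAt_shiftedSinh (θ u : ℝ) :
    HasDerivAt (fun u : ℝ => shiftedSinh θ u) (Complex.cosh (u - θ * Complex.I)) u := by
  have h : HasDerivAt (fun u : ℝ => (u : ℂ) - θ * Complex.I) 1 u :=
    (Complex.ofRealCLM.hasDerivAt (x := u)).sub_const _
  have h2 := (Complex.hasDerivAt_sinh _).comp u h
  rw [mul_one] at h2
  exact h2

/-! ### The kernel -/

/-- The kernel `e^{-iu cot θ} sinh(u)^n / sinh(u - iθ)^{n+1}`, whose integral over `u` is, up to the
factor `2πi`, the product of `P_n(cos θ)` with the Pollaczek weight at `cos θ`. -/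
noncomputable def kernel (n : ℕ) (θ u : ℝ) : ℂ :=
  Complex.exp (-(((Real.cos θ / Real.sin θ * u : ℝ) : ℂ) * Complex.I)) * (Real.sinh u : ℂ) ^ n
    / shiftedSinh θ u ^ (n + 1)

theorem norm_exp_neg_ofReal_mul_I (x : ℝ) : ‖Complex.exp (-((x : ℂ) * Complex.I))‖ = 1 := by
  rw [Complex.norm_exp]
  simp

theorem abs_sin_mul_norm_kernel_le (n : ℕ) (θ u : ℝ) :
    |Real.sin θ| * ‖kernel n θ u‖ ≤ (Real.cosh u)⁻¹ := by
  rcases eq_or_ne (Real.sin θ) 0 with h | h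
  · simpa [h] using (Real.cosh_pos u).le
  have hpos := norm_pos_iff.2 (shiftedSinh_ne_zero h u)
  have h1 := abs_sin_mul_cosh_le_norm_shiftedSinh θ u
  have h2 : ‖kernel n θ u‖ ≤ ‖shiftedSinh θ u‖⁻¹ := by
    rw [kernel, norm_div, norm_mul, norm_exp_neg_ofReal_mul_I, one_mul, norm_pow, norm_pow,
      Complex.norm_real, Real.norm_eq_abs, inv_eq_one_div,
      div_le_div_iff₀ (pow_pos hpos _) hpos, one_mul, pow_succ]
    gcongr
    exact abs_sinh_le_norm_shiftedSinh θ u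
  calc |Real.sin θ| * ‖kernel n θ u‖ ≤ |Real.sin θ| * ‖shiftedSinh θ u‖⁻¹ := by gcongr
    _ ≤ |Real.sin θ| * (|Real.sin θ| * Real.cosh u)⁻¹ := by
        have := mul_pos (abs_pos.2 h) (Real.cosh_pos u)
        gcongr
    _ = (Real.cosh u)⁻¹ := by
        have := (abs_pos.2 h).ne'
        field_simp

theorem measurable_kernel (n : ℕ) : Measurable (Function.uncurry (kernel n)) := by
  unfold Function.uncurry kernel shiftedSinh
  have h1 : Measurable fun p : ℝ × ℝ => Complex.sinh (p.2 - p.1 * Complex.I) :=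
    Complex.continuous_sinh.measurable.comp (by fun_prop)
  have h2 : Measurable fun p : ℝ × ℝ => ((Real.sinh p.2 : ℝ) : ℂ) :=
    Complex.measurable_ofReal.comp (Real.continuous_sinh.measurable.comp measurable_snd)
  fun_prop

theorem integrable_kernel (n : ℕ) {θ : ℝ} (hθ : Real.sin θ ≠ 0) : Integrable (kernel n θ) := by
  have hs := abs_pos.2 hθ
  refine (integrable_inv_cosh.const_mul |Real.sin θ|⁻¹).mono'
    (measurable_kernel n).of_uncurry_left.aestronglyMeasurable
    (Filter.Eventually.of_forall fun u => ?_)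
  rw [← div_eq_inv_mul, le_div_iff₀ hs, mul_comm]
  exact abs_sin_mul_norm_kernel_le n θ u

/-- The three-term combination of the kernels is a total derivative. -/
theorem hasDerivAt_kernel (n : ℕ) {θ : ℝ} (hθ : Real.sin θ ≠ 0) (u : ℝ) :
    HasDerivAt (kernel n θ) (Complex.I / Real.sin θ * ((n + 1) * kernel (n + 1) θ u
      - (2 * n + 2) * Real.cos θ * kernel n θ u + n * kernel (n - 1) θ u)) u := by
  have hs : ((Real.sin θ : ℝ) : ℂ) ≠ 0 := by exact_mod_cast hθ
  have hb := shiftedSinh_ne_zero hθ u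
  have he : HasDerivAt (fun u : ℝ =>
      Complex.exp (-(((Real.cos θ / Real.sin θ * u : ℝ) : ℂ) * Complex.I))) _ u :=
    (((((hasDerivAt_id u).const_mul (Real.cos θ / Real.sin θ)).ofReal_comp).mul_const
      Complex.I).neg).cexp
  have ha : HasDerivAt (fun u : ℝ => (Real.sinh u : ℂ) ^ n) _ u :=
    ((Real.hasDerivAt_sinh u).ofReal_comp).pow n
  have hd := (he.mul ha).div ((hasDerivAt_shiftedSinh θ u).pow (n + 1)) (pow_ne_zero _ hb)
  refine hd.congr_deriv ?_
  have hbe : shiftedSinh θ u = (Real.sinh u : ℂ) * Real.cos θ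
      - Real.cosh u * Real.sin θ * Complex.I := by
    rw [shiftedSinh_eq]; push_cast; ring
  have hce : Complex.cosh (u - θ * Complex.I) = (Real.cosh u : ℂ) * Real.cos θ
      - Real.sinh u * Real.sin θ * Complex.I := by
    rw [Complex.cosh_sub, Complex.cosh_mul_I, Complex.sinh_mul_I]
    push_cast
    ring
  have hcs : (Real.cosh u : ℂ) ^ 2 = (Real.sinh u : ℂ) ^ 2 + 1 := by
    exact_mod_cast Real.cosh_sq u
  have hsc : (Real.cos θ : ℂ) ^ 2 = 1 - (Real.sin θ : ℂ) ^ 2 := by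
    exact_mod_cast Real.cos_sq' θ
  have hI := Complex.I_sq
  have key1 : (Real.sinh u : ℂ) ^ 2 - 2 * Real.cos θ * Real.sinh u * shiftedSinh θ u
      + shiftedSinh θ u ^ 2 = - (Real.sin θ : ℂ) ^ 2 := by
    rw [hbe]
    linear_combination -(Real.sinh u : ℂ) ^ 2 * hsc
      + (Real.cosh u : ℂ) ^ 2 * (Real.sin θ : ℂ) ^ 2 * hI - (Real.sin θ : ℂ) ^ 2 * hcs
  have key2 : (Real.cosh u : ℂ) * shiftedSinh θ u
      - Real.sinh u * Complex.cosh (u - θ * Complex.I) = - Complex.I * Real.sin θ := by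
    rw [hbe, hce]
    linear_combination -(Real.sin θ : ℂ) * Complex.I * hcs
  have key3 : (Real.sinh u : ℂ) - Real.cos θ * shiftedSinh θ u
      = Complex.I * Real.sin θ * Complex.cosh (u - θ * Complex.I) := by
    rw [hbe, hce]
    linear_combination -(Real.sinh u : ℂ) * hsc + (Real.sinh u : ℂ) * (Real.sin θ : ℂ) ^ 2 * hI
  clear hbe hce hcs hsc hd ha he
  simp only [Pi.pow_apply, Pi.mul_apply, Pi.neg_apply, kernel, id, mul_one, Complex.ofReal_div]
  generalize Complex.exp (-(((Real.cos θ / Real.sin θ * u : ℝ) : ℂ) * Complex.I)) = e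
  generalize Complex.cosh (u - θ * Complex.I) = C at *
  generalize shiftedSinh θ u = b at *
  generalize (Real.sinh u : ℂ) = a at *
  generalize (Real.cosh u : ℂ) = c at *
  generalize (Real.cos θ : ℂ) = x at *
  generalize (Real.sin θ : ℂ) = s at *
  rcases n with _ | n
  · simp only [Nat.cast_zero, zero_add, pow_zero, pow_one, zero_mul, mul_zero, add_zero, mul_one,
      Nat.cast_one, Nat.sub_self]
    field_simp
    linear_combination -Complex.I * e * b ^ 2 * key3 - e * b ^ 2 * s * C * hI
  · simp only [Nat.add_sub_cancel, Nat.cast_add, Nat.cast_one]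
    field_simp
    linear_combination e * b ^ 5 * b ^ (n * 3) * a ^ n *
      ((n + 1) * (-Complex.I * key1 + s * key2) - Complex.I * a * key3 - a * s * C * hI)

/-- `∫ kernel` obeys the recurrence of the Pollaczek polynomials. -/
theorem integral_kernel_recurrence (n : ℕ) {θ : ℝ} (hθ : Real.sin θ ≠ 0) :
    (n + 1) * ∫ u, kernel (n + 1) θ u = (2 * n + 2) * Real.cos θ * (∫ u, kernel n θ u)
      - n * ∫ u, kernel (n - 1) θ u := by
  have hs : ((Real.sin θ : ℝ) : ℂ) ≠ 0 := by exact_mod_cast hθ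
  have i1 := (integrable_kernel (n + 1) hθ).const_mul (n + 1 : ℂ)
  have i2 := (integrable_kernel n hθ).const_mul ((2 * n + 2) * Real.cos θ : ℂ)
  have i3 := (integrable_kernel (n - 1) hθ).const_mul (n : ℂ)
  have i12 : Integrable fun u => (n + 1) * kernel (n + 1) θ u
      - (2 * n + 2) * Real.cos θ * kernel n θ u := i1.sub i2
  have h := integral_eq_zero_of_hasDerivAt_of_integrable (hasDerivAt_kernel n hθ)
    ((i12.add i3).const_mul _) (integrable_kernel n hθ)
  rw [integral_const_mul, integral_add i12 i3, integral_sub i1 i2, integral_const_mul,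
    integral_const_mul, integral_const_mul] at h
  have h' := (mul_eq_zero.1 h).resolve_left (div_ne_zero Complex.I_ne_zero hs)
  linear_combination h'

theorem integral_kernel_eq_pollaczek_mul {θ : ℝ} (hθ : Real.sin θ ≠ 0) (n : ℕ) :
    ∫ u, kernel n θ u = pollaczek 1 0 n (Real.cos θ) * ∫ u, kernel 0 θ u := by
  induction n using Nat.twoStepInduction with
  | zero => simp [pollaczek]
  | one =>
    have h := integral_kernel_recurrence 0 hθ
    simp only [Nat.cast_zero, zero_add, mul_zero, zero_mul, sub_zero, one_mul] at h
    rw [h]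
    simp only [pollaczek]
    push_cast
    ring
  | more n h0 h1 =>
    have h := integral_kernel_recurrence (n + 1) hθ
    simp only [Nat.add_sub_cancel, h0, h1] at h
    have hn : (n : ℂ) + 2 ≠ 0 := by exact_mod_cast (by omega : n + 2 ≠ 0)
    simp only [pollaczek]
    push_cast at h ⊢
    field_simp
    linear_combination h

/-! ### The weight as an integral -/

/-- The Fourier transform of the hyperbolic secant, obtained from the Beta integral
`B(1/2 - il/2, 1/2 + il/2)` by the substitution `x = e^u / (2 cosh u)`. -/
theorem integral_exp_neg_mul_I_div_cosh (l : ℝ) :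
    ∫ u : ℝ, Complex.exp (-(((l * u : ℝ) : ℂ) * Complex.I)) / (Real.cosh u : ℂ)
      = ((Real.pi / Real.cosh (Real.pi * l / 2) : ℝ) : ℂ) := by
  set p : ℂ := 1 / 2 - l / 2 * Complex.I with hp
  set q : ℂ := 1 / 2 + l / 2 * Complex.I with hq
  have hpre : p.re = 1 / 2 := by simp [hp]
  have hqre : q.re = 1 / 2 := by simp [hq]
  have hbeta : p.betaIntegral q = ((Real.pi / Real.cosh (Real.pi * l / 2) : ℝ) : ℂ) := by
    have h := Complex.Gamma_mul_Gamma_eq_betaIntegral (s := p) (t := q) (by rw [hpre]; norm_num)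
      (by rw [hqre]; norm_num)
    have hpq : p + q = 1 := by rw [hp, hq]; ring
    have hq1 : q = 1 - p := by rw [← hpq]; ring
    rw [hpq, Complex.Gamma_one, one_mul] at h
    rw [← h, hq1, Complex.Gamma_mul_Gamma_one_sub]
    have : (Real.pi : ℂ) * p = Real.pi / 2 - ((Real.pi * l / 2 : ℝ) : ℂ) * Complex.I := by
      rw [hp]; push_cast; ring
    rw [this, Complex.sin_pi_div_two_sub, Complex.cos_mul_I]
    push_cast
    rfl
  rw [← hbeta, Complex.betaIntegral, intervalIntegral.integral_of_le zero_le_one,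
    integral_Ioc_eq_integral_Ioo]
  have himage : (fun u : ℝ => Real.sigmoid (2 * u)) '' Set.univ = Set.Ioo 0 1 := by
    rw [Set.image_univ, ← Real.range_sigmoid]
    exact (mul_left_surjective₀ (two_ne_zero (α := ℝ))).range_comp Real.sigmoid
  have hd (u : ℝ) : HasDerivAt (fun u : ℝ => Real.sigmoid (2 * u))
      (Real.sigmoid (2 * u) * (1 - Real.sigmoid (2 * u)) * 2) u := by
    have h := (Real.hasDerivAt_sigmoid (2 * u)).comp u ((hasDerivAt_id u).const_mul 2)
    rw [mul_one] at h
    exact h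
  rw [← himage, integral_image_eq_integral_abs_deriv_smul MeasurableSet.univ
    (fun u _ => (hd u).hasDerivWithinAt)
    (fun a _ b _ hab => by simpa using Real.sigmoid_injective hab), setIntegral_univ]
  refine integral_congr_ae (Filter.Eventually.of_forall fun u => ?_)
  have hc := Real.cosh_pos u
  have e1 : Real.sigmoid (2 * u) = Real.exp (u - Real.log (2 * Real.cosh u)) := by
    rw [Real.exp_sub, Real.exp_log (by positivity), Real.sigmoid_def, Real.cosh_eq, inv_eq_one_div,
      div_eq_div_iff (by positivity) (by positivity)]
    have : Real.exp (-(2 * u)) = Real.exp (-u) * Real.exp (-u) := by rw [← Real.exp_add]; ring_nf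
    have h2 : Real.exp u * Real.exp (-u) = 1 := by rw [← Real.exp_add]; simp
    rw [this]
    linear_combination -Real.exp (-u) * h2
  have e2 : 1 - Real.sigmoid (2 * u) = Real.exp (-u - Real.log (2 * Real.cosh u)) := by
    rw [e1, Real.exp_sub, Real.exp_sub, Real.exp_log (by positivity), Real.cosh_eq]
    have := Real.exp_pos u
    have := Real.exp_pos (-u)
    field_simp
    ring
  have h4 : ((Real.exp (Real.log (2 * Real.cosh u)) : ℝ) : ℂ) = 2 * Real.cosh u := by
    rw [Real.exp_log (by positivity)]; push_cast; rfl
  have hcc : (Real.cosh u : ℂ) ≠ 0 := by exact_mod_cast hc.ne'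
  have e3 : ((1 : ℂ) - (Real.sigmoid (2 * u) : ℝ)) = ((1 - Real.sigmoid (2 * u) : ℝ) : ℂ) := by
    push_cast; rfl
  have hcpow (y : ℝ) (z : ℂ) : ((Real.exp y : ℝ) : ℂ) ^ z = Complex.exp (y * z) := by
    rw [Complex.cpow_def_of_ne_zero (by exact_mod_cast (Real.exp_pos y).ne'),
      ← Complex.ofReal_log (Real.exp_pos y).le, Real.log_exp]
  simp only
  rw [e3, e2, e1, abs_of_pos (by positivity), hcpow, hcpow, ← Complex.exp_add, Complex.real_smul,
    div_eq_iff hcc]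
  have h5 (x : ℂ) (y z : ℝ) : ((Real.exp y * Real.exp z * 2 : ℝ) : ℂ) * Complex.exp x
      * Real.cosh u = Complex.exp (x + y + z + (Real.log (2 * Real.cosh u) : ℝ)) := by
    rw [Complex.exp_add, Complex.exp_add, Complex.exp_add, ← Complex.ofReal_exp,
      ← Complex.ofReal_exp, ← Complex.ofReal_exp, h4]
    push_cast
    ring
  rw [h5, hp, hq]
  congr 1
  push_cast
  ring

/-- The function `e^{-ilz} / sinh z`, which is to be integrated along horizontal lines. -/
noncomputable def expDivSinh (l : ℝ) (z : ℂ) : ℂ :=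
  Complex.exp (-(l * z * Complex.I)) / Complex.sinh z

/-- The derivative of `expDivSinh`. -/
noncomputable def expDivSinhDeriv (l : ℝ) (z : ℂ) : ℂ :=
  Complex.exp (-(l * z * Complex.I)) * (-(l * Complex.I) * Complex.sinh z - Complex.cosh z)
    / Complex.sinh z ^ 2

theorem hasDerivAt_expDivSinh (l : ℝ) {z : ℂ} (hz : Complex.sinh z ≠ 0) :
    HasDerivAt (expDivSinh l) (expDivSinhDeriv l z) z := by
  have h := (((((hasDerivAt_id z).const_mul (l : ℂ)).mul_const Complex.I).neg).cexp).div
    (Complex.hasDerivAt_sinh z) hz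
  refine h.congr_deriv ?_
  simp only [expDivSinhDeriv, Pi.neg_apply, id]
  ring

theorem norm_exp_line (l θ u : ℝ) :
    ‖Complex.exp (-(l * (u - θ * Complex.I) * Complex.I))‖ = Real.exp (-(l * θ)) := by
  rw [Complex.norm_exp]
  simp

theorem norm_expDivSinh_le (l : ℝ) {θ : ℝ} (hθ : 0 < Real.sin θ) (u : ℝ) :
    ‖expDivSinh l (u - θ * Complex.I)‖
      ≤ Real.exp (-(l * θ)) * (Real.sin θ)⁻¹ * (Real.cosh u)⁻¹ := by
  have h1 := abs_sin_mul_cosh_le_norm_shiftedSinh θ u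
  rw [abs_of_pos hθ] at h1
  have := Real.cosh_pos u
  rw [expDivSinh, norm_div, norm_exp_line, ← shiftedSinh, mul_assoc, ← mul_inv, div_eq_mul_inv]
  gcongr

theorem norm_expDivSinhDeriv_le (l : ℝ) {θ c : ℝ} (hc : 0 < c) (hθ : c ≤ Real.sin θ) (u : ℝ) :
    ‖expDivSinhDeriv l (u - θ * Complex.I)‖
      ≤ Real.exp (-(l * θ)) * (|l| * c⁻¹ + (c ^ 2)⁻¹) * (Real.cosh u)⁻¹ := by
  have hu := Real.cosh_pos u
  have h1 : c * Real.cosh u ≤ ‖shiftedSinh θ u‖ := by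
    refine le_trans ?_ (abs_sin_mul_cosh_le_norm_shiftedSinh θ u)
    gcongr
    exact hθ.trans (le_abs_self _)
  have hpos : 0 < c * Real.cosh u := mul_pos hc hu
  have h2 := norm_cosh_sub_mul_I_le θ u
  have h3 : shiftedSinh θ u ≠ 0 := norm_pos_iff.1 (hpos.trans_le h1)
  have hsplit : expDivSinhDeriv l (u - θ * Complex.I)
      = Complex.exp (-(l * (u - θ * Complex.I) * Complex.I))
        * (-(l * Complex.I) * (shiftedSinh θ u)⁻¹
          - Complex.cosh (u - θ * Complex.I) * (shiftedSinh θ u ^ 2)⁻¹) := by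
    rw [expDivSinhDeriv, ← shiftedSinh]
    field_simp
  rw [hsplit, norm_mul, norm_exp_line, mul_assoc]
  gcongr
  refine (norm_sub_le _ _).trans ?_
  simp only [norm_mul, norm_neg, norm_inv, norm_pow, Complex.norm_real, Complex.norm_I, mul_one,
    Real.norm_eq_abs]
  calc |l| * ‖shiftedSinh θ u‖⁻¹ + ‖Complex.cosh (u - θ * Complex.I)‖ * (‖shiftedSinh θ u‖ ^ 2)⁻¹
      ≤ |l| * (c * Real.cosh u)⁻¹ + Real.cosh u * ((c * Real.cosh u) ^ 2)⁻¹ := by gcongr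
    _ = (|l| * c⁻¹ + (c ^ 2)⁻¹) * (Real.cosh u)⁻¹ := by field_simp

theorem measurable_expDivSinh (l θ : ℝ) :
    Measurable fun u : ℝ => expDivSinh l (u - θ * Complex.I) := by
  unfold expDivSinh
  have h1 : Measurable fun u : ℝ => Complex.sinh (u - θ * Complex.I) :=
    Complex.continuous_sinh.measurable.comp (by fun_prop)
  fun_prop

theorem measurable_expDivSinhDeriv (l θ : ℝ) :
    Measurable fun u : ℝ => expDivSinhDeriv l (u - θ * Complex.I) := by
  unfold expDivSinhDeriv
  have h1 : Measurable fun u : ℝ => Complex.sinh (u - θ * Complex.I) :=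
    Complex.continuous_sinh.measurable.comp (by fun_prop)
  have h2 : Measurable fun u : ℝ => Complex.cosh (u - θ * Complex.I) :=
    Complex.continuous_cosh.measurable.comp (by fun_prop)
  fun_prop

theorem integrable_expDivSinh (l : ℝ) {θ : ℝ} (hθ : 0 < Real.sin θ) :
    Integrable fun u : ℝ => expDivSinh l (u - θ * Complex.I) :=
  (integrable_inv_cosh.const_mul _).mono' (measurable_expDivSinh l θ).aestronglyMeasurable
    (Filter.Eventually.of_forall fun u => norm_expDivSinh_le l hθ u)

theorem integrable_expDivSinhDeriv (l : ℝ) {θ : ℝ} (hθ : 0 < Real.sin θ) :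
    Integrable fun u : ℝ => expDivSinhDeriv l (u - θ * Complex.I) :=
  (integrable_inv_cosh.const_mul _).mono' (measurable_expDivSinhDeriv l θ).aestronglyMeasurable
    (Filter.Eventually.of_forall fun u => norm_expDivSinhDeriv_le l hθ le_rfl u)

theorem integral_expDivSinhDeriv (l : ℝ) {θ : ℝ} (hθ : 0 < Real.sin θ) :
    ∫ u : ℝ, expDivSinhDeriv l (u - θ * Complex.I) = 0 := by
  refine integral_eq_zero_of_hasDerivAt_of_integrable (fun u => ?_)
    (integrable_expDivSinhDeriv l hθ) (integrable_expDivSinh l hθ)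
  have h : HasDerivAt (fun u : ℝ => (u : ℂ) - θ * Complex.I) 1 u :=
    (Complex.ofRealCLM.hasDerivAt (x := u)).sub_const _
  have h2 := (hasDerivAt_expDivSinh l (shiftedSinh_ne_zero hθ.ne' u)).comp u h
  rw [mul_one] at h2
  exact h2

/-- The integral along `ℝ - iθ` does not depend on `θ ∈ (0, π)`: its derivative with respect to `θ`
is the integral of a total derivative. -/
theorem hasDerivAt_integral_expDivSinh (l : ℝ) {θ : ℝ} (hθ : 0 < Real.sin θ) :
    HasDerivAt (fun θ : ℝ => ∫ u : ℝ, expDivSinh l (u - θ * Complex.I)) 0 θ := by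
  have hs : {t : ℝ | Real.sin θ / 2 < Real.sin t ∧ -(l * t) < -(l * θ) + 1} ∈ nhds θ := by
    have h1 : IsOpen {t : ℝ | Real.sin θ / 2 < Real.sin t} :=
      isOpen_lt continuous_const Real.continuous_sin
    have h2 : IsOpen {t : ℝ | -(l * t) < -(l * θ) + 1} :=
      isOpen_lt (by fun_prop) continuous_const
    exact (h1.inter h2).mem_nhds
      ⟨half_lt_self hθ, show -(l * θ) < -(l * θ) + 1 from lt_add_one _⟩
  have h := (hasDerivAt_integral_of_dominated_loc_of_deriv_le (𝕜 := ℝ) (μ := volume)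
    (F := fun t u => expDivSinh l (u - t * Complex.I))
    (F' := fun t u => expDivSinhDeriv l (u - t * Complex.I) * -Complex.I)
    (bound := fun u => Real.exp (-(l * θ) + 1)
      * (|l| * (Real.sin θ / 2)⁻¹ + ((Real.sin θ / 2) ^ 2)⁻¹) * (Real.cosh u)⁻¹)
    hs (Filter.Eventually.of_forall fun t => (measurable_expDivSinh l t).aestronglyMeasurable)
    (integrable_expDivSinh l hθ) ((measurable_expDivSinhDeriv l θ).mul_const _).aestronglyMeasurable
    (Filter.Eventually.of_forall fun u t ht => ?_) (integrable_inv_cosh.const_mul _)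
    (Filter.Eventually.of_forall fun u t ht => ?_)).2
  · rwa [integral_mul_const, integral_expDivSinhDeriv l hθ, zero_mul] at h
  · rw [norm_mul, norm_neg, Complex.norm_I, mul_one]
    have := Real.cosh_pos u
    refine (norm_expDivSinhDeriv_le l (half_pos hθ) ht.1.le u).trans ?_
    gcongr
    exact ht.2.le
  · have hsin : Real.sin t ≠ 0 := ((half_pos hθ).trans ht.1).ne'
    have h1 : HasDerivAt (fun t : ℝ => (u : ℂ) - t * Complex.I) (-Complex.I) t := by
      have := ((Complex.ofRealCLM.hasDerivAt (x := t)).mul_const Complex.I).const_sub (u : ℂ)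
      simpa using this
    exact (hasDerivAt_expDivSinh l (shiftedSinh_ne_zero hsin u)).comp t h1

theorem integral_expDivSinh (l : ℝ) {θ : ℝ} (h0 : 0 < θ) (hπ : θ < Real.pi) :
    ∫ u : ℝ, expDivSinh l (u - θ * Complex.I)
      = Complex.I * ((Real.exp (-(l * (Real.pi / 2)))
        * (Real.pi / Real.cosh (Real.pi * l / 2)) : ℝ) : ℂ) := by
  have hconst : ∫ u : ℝ, expDivSinh l (u - θ * Complex.I)
      = ∫ u : ℝ, expDivSinh l (u - (Real.pi / 2 : ℝ) * Complex.I) := by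
    have hd (t : ℝ) (ht : t ∈ Set.Ioo 0 Real.pi) := hasDerivAt_integral_expDivSinh l
      (Real.sin_pos_of_mem_Ioo ht)
    exact isOpen_Ioo.is_const_of_deriv_eq_zero isPreconnected_Ioo
      (fun t ht => (hd t ht).differentiableAt.differentiableWithinAt)
      (fun t ht => (hd t ht).deriv) ⟨h0, hπ⟩ ⟨by positivity, by linarith [Real.pi_pos]⟩
  rw [hconst, Complex.ofReal_mul, ← integral_exp_neg_mul_I_div_cosh, ← integral_const_mul,
    ← integral_const_mul]
  refine integral_congr_ae (Filter.Eventually.of_forall fun u => ?_)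
  have hc : (Real.cosh u : ℂ) ≠ 0 := by exact_mod_cast (Real.cosh_pos u).ne'
  simp only [expDivSinh]
  rw [← shiftedSinh, shiftedSinh_eq, Real.cos_pi_div_two, Real.sin_pi_div_two]
  have : -((l : ℂ) * (u - (Real.pi / 2 : ℝ) * Complex.I) * Complex.I)
      = ((-(l * (Real.pi / 2)) : ℝ) : ℂ) + -(((l * u : ℝ) : ℂ) * Complex.I) := by
    push_cast
    linear_combination (l : ℂ) * (Real.pi / 2) * Complex.I_sq
  rw [this, Complex.exp_add, ← Complex.ofReal_exp]
  simp only [mul_zero, mul_one, Complex.ofReal_zero, zero_sub]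
  have hI := Complex.I_ne_zero
  field_simp
  linear_combination -Complex.I_sq

theorem integral_kernel_zero {θ : ℝ} (h0 : 0 < θ) (hπ : θ < Real.pi) :
    ∫ u, kernel 0 θ u = 2 * Real.pi * Complex.I * pollaczekWeight 1 0 (Real.cos θ) := by
  set l : ℝ := Real.cos θ / Real.sin θ with hl
  have h1 (u : ℝ) : kernel 0 θ u
      = ((Real.exp (l * θ) : ℝ) : ℂ) * expDivSinh l (u - θ * Complex.I) := by
    have : -((l : ℂ) * (u - θ * Complex.I) * Complex.I)
        = ((-(l * θ) : ℝ) : ℂ) + -(((l * u : ℝ) : ℂ) * Complex.I) := by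
      push_cast
      linear_combination (l : ℂ) * θ * Complex.I_sq
    rw [kernel, expDivSinh, this, ← shiftedSinh, Complex.exp_add, ← Complex.ofReal_exp, ← hl,
      pow_zero, mul_one, zero_add, pow_one, ← mul_div_assoc, ← mul_assoc, ← Complex.ofReal_mul,
      ← Real.exp_add, add_neg_cancel, Real.exp_zero, Complex.ofReal_one, one_mul]
  simp_rw [h1]
  rw [integral_const_mul, integral_expDivSinh l h0 hπ]
  have h2 : pollaczekWeight 1 0 (Real.cos θ) = Real.exp (l * θ) * (Real.exp (-(l * (Real.pi / 2)))
      * (1 / (2 * Real.cosh (Real.pi * l / 2)))) := by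
    simp only [pollaczekWeight]
    rw [Real.arccos_cos h0.le hπ.le, ← mul_assoc, ← Real.exp_add, mul_one_div]
    have : (1 * Real.cos θ + 0) / (2 * Real.sin θ) = l / 2 := by
      rw [hl]; field_simp; ring
    rw [this]
    congr 3 <;> ring
  rw [h2]
  push_cast
  field_simp

/-! ### Integration of the kernel over the circle -/

theorem norm_exp_neg_mul_cayley_le {u : ℝ} (hu : 0 ≤ u) {z : ℂ} (hz : ‖z‖ ≤ 1) :
    ‖Complex.exp (-(u * ((1 + z) / (1 - z))))‖ ≤ 1 := by
  rw [Complex.norm_exp, Real.exp_le_one_iff, Complex.neg_re, Complex.re_ofReal_mul,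
    neg_nonpos]
  refine mul_nonneg hu ?_
  rw [Complex.div_re, ← add_div]
  refine div_nonneg ?_ (Complex.normSq_nonneg _)
  have h : Complex.normSq z ≤ 1 := by
    rw [Complex.normSq_eq_norm_sq]
    exact pow_le_one₀ (norm_nonneg _) hz
  rw [Complex.normSq_apply] at h
  simp only [Complex.add_re, Complex.one_re, Complex.sub_re, Complex.add_im, Complex.one_im,
    Complex.sub_im]
  nlinarith

/-- The analytic function of the closed unit disc which equals `sin θ · kernel n θ u` at
`z = e^{iθ}`. The factor `1 - z ^ 2` compensates the essential singularities of the exponential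
at `z = ±1`. -/
noncomputable def discKernel (n : ℕ) (u : ℝ) (z : ℂ) : ℂ :=
  Complex.I / 2 * Real.sinh u ^ n * (2 * Real.exp (-u)) ^ (n + 1) * z ^ n
    * ((1 - z ^ 2) * Complex.exp (-(u * ((1 + z ^ 2) / (1 - z ^ 2)))))
    / (1 - Real.exp (-(2 * u)) * z ^ 2) ^ (n + 1)

theorem continuousOn_one_sub_sq_mul_exp {u : ℝ} (hu : 0 ≤ u) :
    ContinuousOn (fun z : ℂ => (1 - z ^ 2) * Complex.exp (-(u * ((1 + z ^ 2) / (1 - z ^ 2)))))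
      (Metric.closedBall 0 1) := by
  intro z hz
  by_cases h : 1 - z ^ 2 = 0
  · have h0 : Filter.Tendsto (fun z : ℂ => ‖1 - z ^ 2‖)
        (nhdsWithin z (Metric.closedBall 0 1)) (nhds 0) := by
      have : Continuous fun z : ℂ => ‖1 - z ^ 2‖ := by fun_prop
      simpa [h] using (this.tendsto z).mono_left nhdsWithin_le_nhds
    rw [ContinuousWithinAt, h, zero_mul]
    refine squeeze_zero_norm' ?_ h0
    filter_upwards [self_mem_nhdsWithin] with w hw
    rw [norm_mul]
    refine mul_le_of_le_one_right (norm_nonneg _) (norm_exp_neg_mul_cayley_le hu ?_)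
    rw [norm_pow]
    exact pow_le_one₀ (norm_nonneg _) (mem_closedBall_zero_iff.1 hw)
  · refine ContinuousAt.continuousWithinAt ?_
    fun_prop (disch := exact h)

theorem one_sub_exp_mul_sq_ne_zero {u : ℝ} (hu : 0 < u) {z : ℂ} (hz : ‖z‖ ≤ 1) :
    1 - (Real.exp (-(2 * u)) : ℂ) * z ^ 2 ≠ 0 := by
  intro h
  have h1 : ‖(Real.exp (-(2 * u)) : ℂ) * z ^ 2‖ < 1 := by
    rw [norm_mul, Complex.norm_real, Real.norm_of_nonneg (Real.exp_pos _).le, norm_pow]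
    have h2 : ‖z‖ ^ 2 ≤ 1 := pow_le_one₀ (norm_nonneg _) hz
    have h3 : Real.exp (-(2 * u)) < 1 := by rw [Real.exp_lt_one_iff]; linarith
    nlinarith [Real.exp_pos (-(2 * u)), sq_nonneg ‖z‖]
  rw [← sub_eq_zero.1 h, norm_one] at h1
  exact lt_irrefl _ h1

theorem diffContOnCl_discKernel (n : ℕ) {u : ℝ} (hu : 0 < u) :
    DiffContOnCl ℂ (discKernel n u) (Metric.ball 0 1) := by
  refine ⟨fun z hz => ?_, ?_⟩
  · have hz1 : ‖z‖ < 1 := by simpa using hz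
    have h1 := one_sub_exp_mul_sq_ne_zero hu hz1.le
    have h2 : 1 - z ^ 2 ≠ 0 := by
      intro h
      have := congrArg norm (sub_eq_zero.1 h)
      rw [norm_one, norm_pow] at this
      nlinarith [norm_nonneg z]
    refine DifferentiableAt.differentiableWithinAt ?_
    unfold discKernel
    have h3 := pow_ne_zero (n + 1) h1
    fun_prop (disch := assumption)
  · rw [closure_ball _ one_ne_zero]
    refine ContinuousOn.div (ContinuousOn.mul (by fun_prop)
      (continuousOn_one_sub_sq_mul_exp hu.le)) (by fun_prop) fun z hz => ?_
    exact pow_ne_zero _ (one_sub_exp_mul_sq_ne_zero hu (mem_closedBall_zero_iff.1 hz))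

theorem discKernel_exp_mul_I (n : ℕ) (u θ : ℝ) :
    discKernel n u (Complex.exp (θ * Complex.I)) = Real.sin θ * kernel n θ u := by
  set z := Complex.exp (θ * Complex.I) with hz
  have hz0 : z ≠ 0 := Complex.exp_ne_zero _
  have hI := Complex.I_ne_zero
  have hI2 := Complex.I_sq
  have hzi : Complex.exp (-(θ * Complex.I)) = z⁻¹ := by rw [Complex.exp_neg]
  have hsin : (Real.sin θ : ℂ) = Complex.I / 2 * (1 - z ^ 2) / z := by
    rw [Complex.ofReal_sin, Complex.sin, neg_mul, hzi, ← hz]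
    field_simp
  have hcos : (Real.cos θ : ℂ) = (1 + z ^ 2) / (2 * z) := by
    rw [Complex.ofReal_cos, Complex.cos, neg_mul, hzi, ← hz]
    field_simp
    ring
  by_cases h : 1 - z ^ 2 = 0
  · rw [hsin, discKernel, h]
    simp
  have he : -(((Real.cos θ / Real.sin θ * u : ℝ) : ℂ) * Complex.I)
      = -(u * ((1 + z ^ 2) / (1 - z ^ 2))) := by
    push_cast
    rw [← Complex.ofReal_cos, ← Complex.ofReal_sin, hsin, hcos]
    field_simp
  have hexp : (Real.exp (-(2 * u)) : ℂ) = Real.exp (-u) ^ 2 := by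
    rw [← Complex.ofReal_pow, ← Real.exp_nat_mul]
    congr 2
    push_cast
    ring
  have hb : shiftedSinh θ u
      = (1 - (Real.exp (-(2 * u)) : ℂ) * z ^ 2) / (2 * Real.exp (-u) * z) := by
    have h0 : (Real.exp (-u) : ℂ) ≠ 0 := by exact_mod_cast (Real.exp_pos (-u)).ne'
    have h1 : Complex.exp (u - θ * Complex.I) = (Real.exp (-u) : ℂ)⁻¹ * z⁻¹ := by
      rw [sub_eq_add_neg, Complex.exp_add, hzi, Complex.ofReal_exp, Complex.ofReal_neg,
        Complex.exp_neg, inv_inv]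
    have h2 : Complex.exp (-(u - θ * Complex.I)) = (Real.exp (-u) : ℂ) * z := by
      rw [neg_sub, sub_eq_add_neg, add_comm, Complex.exp_add, Complex.ofReal_exp,
        Complex.ofReal_neg]
    rw [shiftedSinh, Complex.sinh, h1, h2, hexp]
    field_simp
  rw [discKernel, kernel, he, hb, div_pow, hsin]
  rw [mul_pow _ z (n + 1), pow_succ z n]
  field_simp

theorem integral_circle_kernel (n : ℕ) {u : ℝ} (hu : 0 < u) :
    ∫ θ in (0 : ℝ)..2 * Real.pi, Real.sin θ * kernel n θ u
      = if n = 0 then ((2 * Real.pi * Real.exp (-(2 * u)) : ℝ) : ℂ) * Complex.I else 0 := by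
  have h := (diffContOnCl_discKernel n hu)
  rw [show (1 : ℝ) = |1| from abs_one.symm] at h
  have h1 := h.circleAverage
  rw [Real.circleAverage, inv_smul_eq_iff₀ (by positivity)] at h1
  simp only [circleMap, zero_add, Complex.ofReal_one, one_mul, discKernel_exp_mul_I] at h1
  rw [h1]
  split_ifs with hn
  · subst hn
    simp only [discKernel]
    have : Real.exp (-(2 * u)) = Real.exp (-u) * Real.exp (-u) := by
      rw [← Real.exp_add]; ring_nf
    rw [this]
    simp
    ring
  · simp [discKernel, hn]

/-! ### Vanishing of the moments -/

theorem kernel_neg_neg (n : ℕ) (θ u : ℝ) :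
    (Real.sin (-θ) : ℂ) * kernel n (-θ) u = Real.sin θ * kernel n θ (-u) := by
  have h : shiftedSinh (-θ) u = -shiftedSinh θ (-u) := by
    rw [shiftedSinh, shiftedSinh, ← Complex.sinh_neg]
    congr 1
    push_cast
    ring
  rw [kernel, kernel, h, Real.sin_neg, Real.cos_neg, Real.sinh_neg]
  have : Real.cos θ / -Real.sin θ * u = Real.cos θ / Real.sin θ * -u := by ring
  rw [this]
  push_cast
  rw [neg_pow (Complex.sinh (u : ℂ)), neg_pow (shiftedSinh θ (-u)), pow_succ (-1 : ℂ)]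
  rcases neg_one_pow_eq_or ℂ n with h | h <;> rw [h] <;> ring

theorem kernel_add_two_pi (n : ℕ) (θ u : ℝ) :
    kernel n (θ + 2 * Real.pi) u = kernel n θ u := by
  simp [kernel, shiftedSinh_eq]

theorem intervalIntegrable_sin_mul_kernel (n : ℕ) (u a b : ℝ) :
    IntervalIntegrable (fun θ => (Real.sin θ : ℂ) * kernel n θ u) volume a b := by
  have hk : Measurable fun θ : ℝ => kernel n θ u :=
    (measurable_kernel n).of_uncurry_right
  have hs : Measurable fun θ : ℝ => (Real.sin θ : ℂ) :=
    Complex.measurable_ofReal.comp Real.measurable_sin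
  have hc : IntervalIntegrable (fun _ : ℝ => (Real.cosh u)⁻¹) volume a b :=
    intervalIntegrable_const
  refine hc.mono_fun (hs.mul hk).aestronglyMeasurable ?_
  · refine Filter.Eventually.of_forall fun θ => ?_
    simp only [norm_mul, Complex.norm_real, Real.norm_eq_abs]
    exact (abs_sin_mul_norm_kernel_le n θ u).trans (le_abs_self _)

theorem integral_sin_mul_kernel_add_neg (n : ℕ) (u : ℝ) :
    (∫ θ in (0 : ℝ)..Real.pi, (Real.sin θ : ℂ) * kernel n θ u)
      + (∫ θ in (0 : ℝ)..Real.pi, (Real.sin θ : ℂ) * kernel n θ (-u))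
      = ∫ θ in (0 : ℝ)..2 * Real.pi, (Real.sin θ : ℂ) * kernel n θ u := by
  rw [← intervalIntegral.integral_add_adjacent_intervals
    (intervalIntegrable_sin_mul_kernel n u 0 Real.pi)
    (intervalIntegrable_sin_mul_kernel n u Real.pi (2 * Real.pi))]
  congr 1
  have h := intervalIntegral.integral_comp_sub_left (a := 0) (b := Real.pi)
    (fun θ => (Real.sin θ : ℂ) * kernel n θ u) (2 * Real.pi)
  rw [sub_zero, show 2 * Real.pi - Real.pi = Real.pi by ring] at h
  rw [← h]
  refine intervalIntegral.integral_congr fun θ _ => ?_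
  rw [← kernel_neg_neg, show 2 * Real.pi - θ = -θ + 2 * Real.pi by ring, kernel_add_two_pi,
    Real.sin_add_two_pi]

theorem integral_sin_mul_integral_kernel (n : ℕ) :
    ∫ θ in (0 : ℝ)..Real.pi, (Real.sin θ : ℂ) * ∫ u, kernel n θ u
      = if n = 0 then Real.pi * Complex.I else 0 := by
  have hint : Integrable (Function.uncurry fun (θ u : ℝ) => (Real.sin θ : ℂ) * kernel n θ u)
      ((volume.restrict (Set.Ioc 0 Real.pi)).prod volume) := by
    refine (integrable_inv_cosh.comp_snd (volume.restrict (Set.Ioc 0 Real.pi))).mono' ?_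
      (Filter.Eventually.of_forall fun p => ?_)
    · refine Measurable.aestronglyMeasurable (Measurable.mul ?_ (measurable_kernel n))
      exact Complex.measurable_ofReal.comp (Real.measurable_sin.comp measurable_fst)
    · simp only [Function.uncurry, norm_mul, Complex.norm_real, Real.norm_eq_abs]
      exact abs_sin_mul_norm_kernel_le n p.1 p.2
  have hG := hint.integral_prod_right
  simp only [Function.uncurry] at hG
  simp_rw [intervalIntegral.integral_of_le Real.pi_pos.le, ← integral_const_mul]
  rw [integral_integral_swap hint, ← intervalIntegral.integral_Iic_add_Ioi (b := 0)
    hG.integrableOn hG.integrableOn]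
  have hneg := integral_comp_neg_Ioi (0 : ℝ)
    (fun u => ∫ θ in Set.Ioc 0 Real.pi, (Real.sin θ : ℂ) * kernel n θ u)
  rw [neg_zero] at hneg
  rw [← hneg, ← integral_add hG.comp_neg.integrableOn hG.integrableOn]
  -- Folding the line at `u = 0` completes the half circle `0 < θ < π` to the whole circle.
  have hcirc : ∀ u ∈ Set.Ioi (0 : ℝ),
      (∫ θ in Set.Ioc 0 Real.pi, (Real.sin θ : ℂ) * kernel n θ (-u))
        + (∫ θ in Set.Ioc 0 Real.pi, (Real.sin θ : ℂ) * kernel n θ u)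
      = if n = 0 then ((2 * Real.pi * Real.exp (-(2 * u)) : ℝ) : ℂ) * Complex.I else 0 := by
    intro u hu
    have h := integral_sin_mul_kernel_add_neg n u
    rw [integral_circle_kernel n hu] at h
    simp_rw [intervalIntegral.integral_of_le Real.pi_pos.le] at h
    rw [add_comm, h]
  rw [setIntegral_congr_fun measurableSet_Ioi hcirc]
  split_ifs with hn
  · rw [integral_mul_const, integral_complex_ofReal, integral_const_mul]
    have := integral_exp_mul_Ioi (a := -2) (by norm_num) 0
    simp only [neg_mul] at this
    rw [this]
    simp only [mul_zero, neg_zero, Real.exp_zero]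
    push_cast
    ring
  · simp

/-- The Pollaczek polynomials of positive degree have mean zero for the Pollaczek weight, whose
total mass is `1/2`. -/
theorem integral_pollaczek_mul_weight (n : ℕ) :
    ∫ x in (-1 : ℝ)..1, pollaczek 1 0 n x * pollaczekWeight 1 0 x
      = if n = 0 then 1 / 2 else 0 := by
  have h := integral_sin_mul_integral_kernel n
  rw [intervalIntegral.integral_of_le Real.pi_pos.le, integral_Ioc_eq_integral_Ioo] at h
  have h1 : ∀ θ ∈ Set.Ioo 0 Real.pi, (Real.sin θ : ℂ) * ∫ u, kernel n θ u
      = 2 * Real.pi * Complex.I * ((|-Real.sin θ| •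
        (pollaczek 1 0 n (Real.cos θ) * pollaczekWeight 1 0 (Real.cos θ)) : ℝ) : ℂ) := by
    intro θ hθ
    have hs := Real.sin_pos_of_mem_Ioo hθ
    rw [integral_kernel_eq_pollaczek_mul hs.ne', integral_kernel_zero hθ.1 hθ.2, abs_neg,
      abs_of_pos hs, smul_eq_mul]
    push_cast
    ring
  rw [setIntegral_congr_fun measurableSet_Ioo h1, integral_const_mul, integral_complex_ofReal,
    ← integral_image_eq_integral_abs_deriv_smul measurableSet_Ioo
      (fun θ _ => (Real.hasDerivAt_cos θ).hasDerivWithinAt)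
      (Real.injOn_cos.mono Set.Ioo_subset_Icc_self)
      (fun x => pollaczek 1 0 n x * pollaczekWeight 1 0 x)] at h
  have himage : Real.cos '' Set.Ioo 0 Real.pi = Set.Ioo (-1) 1 :=
    Real.cosPartialHomeomorph.image_source_eq_target
  rw [himage, ← integral_Ioc_eq_integral_Ioo, ← intervalIntegral.integral_of_le (by norm_num)] at h
  have hc : (2 * Real.pi * Complex.I : ℂ) ≠ 0 := Complex.two_pi_I_ne_zero
  split_ifs at h ⊢ with hn
  · have h2 : (2 * Real.pi * Complex.I : ℂ) * ((1 / 2 : ℝ) : ℂ) = Real.pi * Complex.I := by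
      push_cast
      ring
    rw [← h2] at h
    exact_mod_cast mul_left_cancel₀ hc h
  · exact_mod_cast (mul_eq_zero.1 h).resolve_left hc

/-! ### The measure `ψ` and the polynomials `Q_n` -/

theorem continuous_pollaczek (a b : ℝ) (n : ℕ) : Continuous (pollaczek a b n) := by
  induction n using Nat.twoStepInduction with
  | zero => simp only [pollaczek]; fun_prop
  | one => simp only [pollaczek]; fun_prop
  | more n h0 h1 => simp only [pollaczek]; fun_prop

theorem continuous_Q (ρ : ℝ) (n : ℕ) : Continuous (Q ρ n) := by
  have := continuous_pollaczek 1 0 n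
  unfold Q
  fun_prop

theorem pollaczek_recurrence (n : ℕ) (x : ℝ) :
    ((n : ℝ) + 1) * pollaczek 1 0 (n + 1) x
      = (2 * n + 2) * x * pollaczek 1 0 n x - n * pollaczek 1 0 (n - 1) x := by
  rcases n with _ | n
  · simp only [pollaczek, Nat.cast_zero]; ring
  · simp only [pollaczek, Nat.add_sub_cancel, Nat.cast_add, Nat.cast_one]
    have : (n : ℝ) + 2 ≠ 0 := by positivity
    field_simp
    ring

/-- Multiplication by `x` acts on the `Q_n` as the transition matrix of the chain killed at the
departure of the tagged customer. -/
theorem mul_Q {ρ : ℝ} (hρ : 0 < ρ) (n : ℕ) (x : ℝ) :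
    x * Q ρ n x = ρ / (1 + ρ) * Q ρ (n + 1) x
      + n / ((n + 1) * (1 + ρ)) * Q ρ (n - 1) x := by
  have hr := Real.sqrt_pos.2 hρ
  have hsq := Real.sq_sqrt hρ.le
  simp only [Q]
  set r := Real.sqrt ρ
  rw [← hsq]
  set y := (1 + r ^ 2) / (2 * r) * x with hy
  have hx : x = 2 * r / (1 + r ^ 2) * y := by rw [hy]; field_simp
  have h := pollaczek_recurrence n y
  rw [hx]
  rcases n with _ | n
  · simp only [Nat.cast_zero, zero_add, mul_zero, zero_mul, sub_zero, one_mul, zero_div, add_zero]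
      at h ⊢
    rw [h]
    field_simp
  · simp only [Nat.add_sub_cancel, Nat.cast_add, Nat.cast_one] at h ⊢
    have h2 : (n : ℝ) + 1 + 1 ≠ 0 := by positivity
    rw [mul_comm, ← eq_div_iff h2] at h
    rw [h]
    field_simp
    ring

theorem pollaczekWeight_nonneg (x : ℝ) : 0 ≤ pollaczekWeight 1 0 x := by
  simp only [pollaczekWeight]
  have := Real.cosh_pos (Real.pi * ((1 * Real.cos (Real.arccos x) + 0)
    / (2 * Real.sin (Real.arccos x))))
  positivity

theorem pollaczekWeight_le_one (x : ℝ) : pollaczekWeight 1 0 x ≤ 1 := by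
  simp only [pollaczekWeight]
  set t := (1 * Real.cos (Real.arccos x) + 0) / (2 * Real.sin (Real.arccos x))
  rw [div_le_one (by have := Real.cosh_pos (Real.pi * t); positivity)]
  have h1 := Real.arccos_nonneg x
  have h2 := Real.arccos_le_pi x
  have h3 : (2 * Real.arccos x - Real.pi) * t ≤ |Real.pi * t| := by
    refine (le_abs_self _).trans ?_
    rw [abs_mul, abs_mul, abs_of_pos Real.pi_pos]
    gcongr
    exact abs_le.2 ⟨by linarith, by linarith⟩
  calc Real.exp ((2 * Real.arccos x - Real.pi) * t) ≤ Real.exp |Real.pi * t| := by gcongr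
    _ ≤ 2 * Real.cosh |Real.pi * t| := by
        rw [Real.cosh_eq]
        linarith [Real.exp_pos (-|Real.pi * t|)]
    _ = 2 * Real.cosh (Real.pi * t) := by rw [Real.cosh_abs]

theorem measurable_pollaczekWeight : Measurable (pollaczekWeight 1 0) := by
  unfold pollaczekWeight
  have h1 : Measurable Real.arccos := Real.continuous_arccos.measurable
  have h2 (f : ℝ → ℝ) (hf : Measurable f) : Measurable fun x => Real.cosh (f x) :=
    Real.continuous_cosh.measurable.comp hf
  refine Measurable.div (by fun_prop) ((h2 _ ?_).const_mul 2)
  fun_prop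

theorem edge_pos {ρ : ℝ} (hρ : 0 < ρ) : 0 < edge ρ := by
  have := Real.sqrt_pos.2 hρ
  unfold edge
  positivity

theorem psi_le (ρ : ℝ) : psi ρ ≤ ENNReal.ofReal ((1 + ρ) / Real.sqrt ρ) •
    volume.restrict (Set.Icc (-edge ρ) (edge ρ)) := by
  rw [← withDensity_const]
  refine withDensity_mono (Filter.Eventually.of_forall fun x => ?_)
  rcases le_total 0 ((1 + ρ) / Real.sqrt ρ) with h | h
  · exact ENNReal.ofReal_le_ofReal (mul_le_of_le_one_right h (pollaczekWeight_le_one _))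
  · simp only
    rw [ENNReal.ofReal_of_nonpos (mul_nonpos_of_nonpos_of_nonneg h (pollaczekWeight_nonneg _))]
    exact zero_le

theorem integrable_psi (ρ : ℝ) {f : ℝ → ℝ} (hf : Continuous f) : Integrable f (psi ρ) := by
  have h : IntegrableOn f (Set.Icc (-edge ρ) (edge ρ)) := hf.integrableOn_Icc
  exact (h.smul_measure ENNReal.ofReal_ne_top).mono_measure (psi_le ρ)

theorem integral_psi {ρ : ℝ} (hρ : 0 < ρ) (f : ℝ → ℝ) :
    ∫ x, f x ∂(psi ρ) = 2 * ∫ y in (-1 : ℝ)..1, f (edge ρ * y) * pollaczekWeight 1 0 y := by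
  have he := edge_pos hρ
  have hr := Real.sqrt_pos.2 hρ
  have h1 : (1 + ρ) / (2 * Real.sqrt ρ) = (edge ρ)⁻¹ := by rw [edge, inv_div]
  have h2 : (1 + ρ) / Real.sqrt ρ = 2 * (edge ρ)⁻¹ := by
    rw [edge, inv_div]; field_simp
  have hm : Measurable fun x => ENNReal.ofReal ((1 + ρ) / Real.sqrt ρ
      * pollaczekWeight 1 0 ((1 + ρ) / (2 * Real.sqrt ρ) * x)) :=
    ((measurable_pollaczekWeight.comp (measurable_const_mul _)).const_mul _).ennreal_ofReal
  rw [psi, integral_withDensity_eq_integral_toReal_smul hm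
    (Filter.Eventually.of_forall fun x => ENNReal.ofReal_lt_top), integral_Icc_eq_integral_Ioc,
    ← intervalIntegral.integral_of_le (by linarith)]
  have h3 := intervalIntegral.integral_comp_mul_left (a := -1) (b := 1) (c := edge ρ)
    (fun x => f x * pollaczekWeight 1 0 ((edge ρ)⁻¹ * x)) he.ne'
  simp only [inv_mul_cancel_left₀ he.ne'] at h3
  rw [h3, mul_one, mul_neg_one, smul_eq_mul, ← mul_assoc, ← intervalIntegral.integral_const_mul]
  refine intervalIntegral.integral_congr fun x _ => ?_
  rw [h1, h2, ENNReal.toReal_ofReal, smul_eq_mul]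
  · ring
  · exact mul_nonneg (by positivity) (pollaczekWeight_nonneg _)

theorem integral_Q {ρ : ℝ} (hρ : 0 < ρ) (n : ℕ) :
    ∫ x, Q ρ n x ∂(psi ρ) = if n = 0 then 1 else 0 := by
  have he := edge_pos hρ
  have hr := Real.sqrt_pos.2 hρ
  have h1 : (1 + ρ) / (2 * Real.sqrt ρ) = (edge ρ)⁻¹ := by rw [edge, inv_div]
  rw [integral_psi hρ]
  simp only [Q, h1, inv_mul_cancel_left₀ he.ne', mul_assoc]
  rw [intervalIntegral.integral_const_mul, integral_pollaczek_mul_weight]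
  split_ifs with hn
  · subst hn; norm_num
  · simp

/-- The moments `∫ x^k Q_m Q_n dψ`. -/
noncomputable def moment (ρ : ℝ) (k m n : ℕ) : ℝ := ∫ x, x ^ k * Q ρ m x * Q ρ n x ∂(psi ρ)

theorem integrable_pow_mul_Q_mul_Q (ρ : ℝ) (k m n : ℕ) :
    Integrable (fun x => x ^ k * Q ρ m x * Q ρ n x) (psi ρ) :=
  integrable_psi ρ (((continuous_pow k).mul (continuous_Q ρ m)).mul (continuous_Q ρ n))

theorem moment_comm (ρ : ℝ) (k m n : ℕ) : moment ρ k m n = moment ρ k n m := by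
  simp only [moment, mul_right_comm]

theorem moment_succ {ρ : ℝ} (hρ : 0 < ρ) (k m n : ℕ) :
    moment ρ (k + 1) m n = ρ / (1 + ρ) * moment ρ k (m + 1) n
      + m / ((m + 1) * (1 + ρ)) * moment ρ k (m - 1) n := by
  simp only [moment]
  rw [← integral_const_mul, ← integral_const_mul, ← integral_add
    ((integrable_pow_mul_Q_mul_Q ρ k _ n).const_mul _)
    ((integrable_pow_mul_Q_mul_Q ρ k _ n).const_mul _)]
  refine integral_congr_ae (Filter.Eventually.of_forall fun x => ?_)
  simp only
  rw [pow_succ, mul_assoc (x ^ k), mul_Q hρ]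
  ring

/-- Orthogonality of the `Q_n`. -/
theorem moment_zero {ρ : ℝ} (hρ : 0 < ρ) (m n : ℕ) :
    moment ρ 0 m n = if m = n then 1 / (((n : ℝ) + 1) * ρ ^ n) else 0 := by
  -- Both sides of the recurrence compute `∫ x Q_m Q_n dψ`.
  have key (m n : ℕ) : moment ρ 0 (m + 1) n
      = moment ρ 0 m (n + 1) + n / ((n + 1) * ρ) * moment ρ 0 m (n - 1)
        - m / ((m + 1) * ρ) * moment ρ 0 (m - 1) n := by
    have h1 := moment_succ hρ 0 m n
    have h2 := moment_succ hρ 0 n m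
    rw [moment_comm, moment_comm _ _ _ m, moment_comm _ _ _ m, h1] at h2
    field_simp at h2 ⊢
    linarith
  have hbase (n : ℕ) : moment ρ 0 0 n = if 0 = n then 1 / (((n : ℝ) + 1) * ρ ^ n) else 0 := by
    have : moment ρ 0 0 n = ∫ x, Q ρ n x ∂(psi ρ) := by simp [moment, Q, pollaczek]
    rw [this, integral_Q hρ]
    rcases n with _ | n <;> simp
  induction m using Nat.twoStepInduction generalizing n with
  | zero => exact hbase n
  | one =>
    rw [key 0 n, hbase, hbase]
    rcases n with _ | _ | n <;> simp
  | more m h0 h1 =>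
    rw [key (m + 1) n, h1, h1, Nat.add_sub_cancel, h0]
    rcases eq_or_ne n m with rfl | hnm
    · rw [if_pos rfl, if_neg (by omega), if_pos rfl, if_neg (by omega)]
      push_cast
      field_simp
      ring
    · rw [if_neg (by omega), if_neg (Ne.symm hnm)]
      rcases eq_or_ne n (m + 2) with rfl | hn2
      · rw [show m + 2 - 1 = m + 1 from rfl, if_pos rfl, if_pos rfl]
        push_cast
        field_simp
        ring
      · rw [if_neg (by omega), if_neg (Ne.symm hn2)]
        simp

/-! ### The Markov property for events of the past -/

section Markov

variable {Ω S : Type*} [MeasurableSpace Ω] {μ : Measure Ω} {P : S → S → ℝ} {N : ℕ → Ω → S}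

theorem IsMarkovChain.measurableSet_mem [Countable S] (hN : IsMarkovChain μ P N) (k : ℕ)
    (T : Set S) : MeasurableSet {ω | N k ω ∈ T} := by
  have : {ω | N k ω ∈ T} = ⋃ s ∈ T, {ω | N k ω = s} := by
    ext ω
    simp
  rw [this]
  exact MeasurableSet.biUnion T.to_countable fun s _ => hN.measurableSet_eq k s

/-- The Markov property for an event `H` determined by the first `k + 1` states: it holds for each
of the countably many histories. -/
theorem IsMarkovChain.measureReal_step [Countable S] [IsFiniteMeasure μ]
    (hN : IsMarkovChain μ P N) (k : ℕ) (H : (ℕ → S) → Prop)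
    (hH : ∀ x y : ℕ → S, (∀ i ≤ k, x i = y i) → H x → H y) {a b : S} (hP : 0 ≤ P a b) :
    μ.real {ω | (H (fun i => N i ω) ∧ N k ω = a) ∧ N (k + 1) ω = b}
      = μ.real {ω | H (fun i => N i ω) ∧ N k ω = a} * P a b := by
  let hist : Ω → Fin (k + 1) → S := fun ω i => N i ω
  let ext : (Fin (k + 1) → S) → ℕ → S := fun h i => h ⟨min i k, by omega⟩
  let B : Set (Fin (k + 1) → S) := {h | H (ext h) ∧ h (Fin.last k) = a}
  let E : Set Ω := {ω | N (k + 1) ω = b}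
  have hext (ω : Ω) : ∀ i ≤ k, ext (hist ω) i = N i ω := by
    intro i hi
    simp only [ext, hist, min_eq_left hi]
  have hpre : {ω | H (fun i => N i ω) ∧ N k ω = a} = hist ⁻¹' B := by
    ext ω
    refine and_congr ⟨fun h => ?_, fun h => ?_⟩ Iff.rfl
    · exact hH _ _ (fun i hi => (hext ω i hi).symm) h
    · exact hH _ _ (hext ω) h
  have hmeas (h : Fin (k + 1) → S) : MeasurableSet (hist ⁻¹' {h}) := by
    have : hist ⁻¹' {h} = ⋂ i : Fin (k + 1), {ω | N i ω = h i} := by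
      ext ω
      simp [hist, funext_iff]
    rw [this]
    exact MeasurableSet.iInter fun i => hN.measurableSet_eq i (h i)
  have hstep (h : B) : μ.restrict E (hist ⁻¹' {h.1})
      = μ (hist ⁻¹' {h.1}) * ENNReal.ofReal (P a b) := by
    rw [Measure.restrict_apply (hmeas _)]
    let s : ℕ → S := fun i => if i ≤ k then ext h.1 i else b
    have e0 (ω : Ω) : hist ω = h.1 ↔ ∀ i ≤ k, N i ω = s i := by
      constructor
      · intro hω i hi
        simp only [s, if_pos hi, ← hω, hext ω i hi]
      · intro hω
        funext i
        have hi : (i : ℕ) ≤ k := Nat.lt_succ_iff.1 i.2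
        simp only [hist, hω i hi, s, if_pos hi, ext, min_eq_left hi]
    have e1 : hist ⁻¹' {h.1} = {ω | ∀ i ≤ k, N i ω = s i} := by
      ext ω
      exact e0 ω
    have e2 : hist ⁻¹' {h.1} ∩ E = {ω | ∀ i ≤ k + 1, N i ω = s i} := by
      rw [e1]
      ext ω
      simp only [Set.mem_inter_iff, Set.mem_ofPred_eq, E]
      constructor
      · rintro ⟨h1, h2⟩ i hi
        rcases Nat.le_succ_iff.1 hi with hi | rfl
        · exact h1 i hi
        · simp [s, h2]
      · intro h1
        exact ⟨fun i hi => h1 i (by omega), by simpa [s] using h1 (k + 1) le_rfl⟩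
    have hsk : s k = a := by
      have := h.2.2
      simp only [s, le_refl, if_true, ext, min_self]
      exact this
    have hsk1 : s (k + 1) = b := by simp [s]
    have hm := hN.markov k s
    rw [hsk, hsk1] at hm
    rw [e2, e1, ← ofReal_measureReal, ← ofReal_measureReal, hm,
      ENNReal.ofReal_mul measureReal_nonneg]
  have hkey : μ.restrict E (hist ⁻¹' B) = μ (hist ⁻¹' B) * ENNReal.ofReal (P a b) := by
    rw [← tsum_measure_preimage_singleton B.to_countable fun h _ => hmeas h,
      ← tsum_measure_preimage_singleton B.to_countable fun h _ => hmeas h, ← ENNReal.tsum_mul_right]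
    exact tsum_congr hstep
  have hE : MeasurableSet E := hN.measurableSet_eq _ _
  rw [Measure.restrict_apply' hE] at hkey
  have hgoal : {ω | (H (fun i => N i ω) ∧ N k ω = a) ∧ N (k + 1) ω = b} = hist ⁻¹' B ∩ E := by
    rw [← hpre]
    rfl
  rw [hgoal, hpre, measureReal_def, hkey, ENNReal.toReal_mul, ← measureReal_def]
  rw [ENNReal.toReal_ofReal hP]

end Markov

/-! ### Trajectories of the queue -/

/-- Trajectories all of whose steps are possible: the absorbing state is never left, and the number
of other customers changes by at most one. -/
def IsPath (x : ℕ → State) : Prop :=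
  ∀ k, (x k = none → x (k + 1) = none) ∧ ∀ n, x k = some n →
    x (k + 1) = none ∨ x (k + 1) = some (n + 1) ∨ ∃ m, n = m + 1 ∧ x (k + 1) = some m

theorem IsPath.le_add {x : ℕ → State} (hx : IsPath x) {n : ℕ} (h0 : x 0 = some n) (k : ℕ) :
    ∀ m, x k = some m → m ≤ n + k := by
  induction k with
  | zero =>
    intro m hm
    rw [h0] at hm
    simp at hm
    omega
  | succ k ih =>
    intro m hm
    rcases hk : x k with _ | l
    · rw [(hx k).1 hk] at hm
      simp at hm
    · have := ih l hk
      rcases (hx k).2 l hk with h | h | ⟨l', hl, h⟩ <;> rw [h] at hm <;> simp at hm <;> omega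

open Classical in
/-- On a trajectory which starts from `n` other customers and is absorbed in step `K + 1` from the
state `m`, the numbers `a` of arrivals and `d` of departures satisfy `a + d = K` and
`n + a = m + d`. -/
theorem IsPath.exists_arrivals_departures {x : ℕ → State} (hx : IsPath x) {n m K : ℕ}
    (h0 : x 0 = some n) (hne : ∀ i ≤ K, x i ≠ none) (hK : x K = some m) (hend : x (K + 1) = none) :
    ∃ a d : ℕ, arrivals x = a ∧ departures x = d ∧ a + d = K ∧ n + a = m + d := by
  set U : Set ℕ :=
    {k : ℕ | (∀ i ≤ k, x i ≠ none) ∧ ∃ n : ℕ, x k = some n ∧ x (k + 1) = some (n + 1)} with hU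
  set D : Set ℕ :=
    {k : ℕ | (∀ i ≤ k, x i ≠ none) ∧ ∃ n : ℕ, x k = some (n + 1) ∧ x (k + 1) = some n} with hD
  have hlt (k : ℕ) (h1 : ∀ i ≤ k, x i ≠ none) (h2 : x (k + 1) ≠ none) : k < K := by
    by_contra hk
    rcases (not_lt.1 hk).lt_or_eq with h | h
    · exact h1 (K + 1) h hend
    · subst h
      exact h2 hend
  have hUset : U = ↑((Finset.range K).filter (· ∈ U)) := by
    ext k
    simp only [Finset.coe_filter, Finset.mem_range, Set.mem_ofPred_eq]
    refine ⟨fun h => ⟨?_, h⟩, fun h => h.2⟩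
    obtain ⟨h1, l, -, h2⟩ := h
    exact hlt k h1 (by simp [h2])
  have hDset : D = ↑((Finset.range K).filter (· ∈ D)) := by
    ext k
    simp only [Finset.coe_filter, Finset.mem_range, Set.mem_ofPred_eq]
    refine ⟨fun h => ⟨?_, h⟩, fun h => h.2⟩
    obtain ⟨h1, l, -, h2⟩ := h
    exact hlt k h1 (by simp [h2])
  have hind (k : ℕ) (hk : k ≤ K) : ∃ l, x k = some l ∧
      ((Finset.range k).filter (· ∈ U)).card + ((Finset.range k).filter (· ∈ D)).card = k ∧
      n + ((Finset.range k).filter (· ∈ U)).card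
        = l + ((Finset.range k).filter (· ∈ D)).card := by
    induction k with
    | zero => exact ⟨n, h0, by simp, by simp⟩
    | succ k ih =>
      obtain ⟨l, hl, h1, h2⟩ := ih (by omega)
      have hpast : ∀ i ≤ k, x i ≠ none := fun i hi => hne i (by omega)
      have hkn : k ∉ Finset.range k := by simp
      rcases (hx k).2 l hl with h | h | ⟨l', rfl, h⟩
      · exact absurd h (hne _ hk)
      · have hkU : k ∈ U := ⟨hpast, l, hl, h⟩
        have hkD : k ∉ D := by
          rintro ⟨-, p, hp1, hp2⟩
          rw [hl] at hp1
          rw [h] at hp2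
          simp at hp1 hp2
          omega
        refine ⟨l + 1, h, ?_⟩
        rw [Finset.range_add_one, Finset.filter_insert, Finset.filter_insert, if_pos hkU,
          if_neg hkD, Finset.card_insert_of_notMem (by simp)]
        omega
      · have hkD : k ∈ D := ⟨hpast, l', hl, h⟩
        have hkU : k ∉ U := by
          rintro ⟨-, p, hp1, hp2⟩
          rw [hl] at hp1
          rw [h] at hp2
          simp at hp1 hp2
          omega
        refine ⟨l', h, ?_⟩
        rw [Finset.range_add_one, Finset.filter_insert, Finset.filter_insert, if_pos hkD,
          if_neg hkU, Finset.card_insert_of_notMem (by simp)]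
        omega
  obtain ⟨l, hl, h1, h2⟩ := hind K le_rfl
  have hlm : l = m := by
    rw [hK] at hl
    simpa using hl.symm
  subst hlm
  refine ⟨_, _, ?_, ?_, h1, h2⟩
  · exact (congrArg Set.encard hUset).trans (Set.encard_coe_eq_coe_finsetCard _)
  · exact (congrArg Set.encard hDset).trans (Set.encard_coe_eq_coe_finsetCard _)

/-! ### The stationary distribution -/

theorem IsStationaryQueueLength.eq_geometric {ρ : ℝ} (hρ0 : 0 < ρ) (hρ1 : ρ < 1) {p : ℕ → ℝ}
    (hp : IsStationaryQueueLength ρ p) (n : ℕ) : p n = (1 - ρ) * ρ ^ n := by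
  have hstep (n : ℕ) : p (n + 1) = ρ * p n := by
    induction n with
    | zero => exact hp.balance_zero.symm
    | succ n ih => linarith [hp.balance_succ n]
  have hpow (n : ℕ) : p n = p 0 * ρ ^ n := by
    induction n with
    | zero => simp
    | succ n ih => rw [hstep, ih]; ring
  have hsum : HasSum p (p 0 * (1 - ρ)⁻¹) := by
    have := (hasSum_geometric_of_lt_one hρ0.le hρ1).mul_left (p 0)
    rwa [← funext hpow] at this
  have h1 := hsum.unique hp.hasSum_one
  have h2 : 1 - ρ ≠ 0 := by linarith
  rw [← div_eq_mul_inv, div_eq_iff h2, one_mul] at h1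
  rw [hpow, h1]

/-! ### The killed chain -/

theorem transition_nonneg {ρ : ℝ} (hρ : 0 < ρ) (a b : State) : 0 ≤ transition ρ a b := by
  rcases a with _ | n <;> rcases b with _ | m <;> simp only [transition] <;>
    [skip; skip; positivity; (split_ifs <;> positivity)] <;> norm_num

section Chain

variable {Ω : Type*}

/-- The tagged customer finds `n` customers and is still in the queue after `k` events. -/
def survival (N : ℕ → Ω → State) (k n : ℕ) : Set Ω := {ω | N 0 ω = some n ∧ ∀ i ≤ k, N i ω ≠ none}

/-- The tagged customer finds `n` customers and, after `k` events, is still in the queue with `m`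
other customers. -/
def stay (N : ℕ → Ω → State) (k n m : ℕ) : Set Ω :=
  {ω | (N 0 ω = some n ∧ ∀ i ≤ k, N i ω ≠ none) ∧ N k ω = some m}

/-- The tagged customer finds `n` customers and leaves the queue with the event `k + 1`, leaving `m`
customers behind. -/
def exit (N : ℕ → Ω → State) (k n m : ℕ) : Set Ω :=
  {ω | ((N 0 ω = some n ∧ ∀ i ≤ k, N i ω ≠ none) ∧ N k ω = some m) ∧ N (k + 1) ω = none}

theorem exit_unique {N : ℕ → Ω → State} {ω : Ω} {k n m k' n' m' : ℕ}
    (h : ω ∈ exit N k n m) (h' : ω ∈ exit N k' n' m') : k = k' ∧ n = n' ∧ m = m' := by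
  obtain ⟨⟨⟨h0, hne⟩, hk⟩, hend⟩ := h
  obtain ⟨⟨⟨h0', hne'⟩, hk'⟩, hend'⟩ := h'
  have hkk : k = k' := by
    rcases lt_trichotomy k k' with h | h | h
    · exact absurd hend (hne' _ h)
    · exact h
    · exact absurd hend' (hne _ h)
  subst hkk
  rw [h0] at h0'
  rw [hk] at hk'
  exact ⟨rfl, by simpa using h0', by simpa using hk'⟩

variable [MeasurableSpace Ω] {μ : Measure Ω} {ρ : ℝ} {N : ℕ → Ω → State}

theorem measurableSet_survival (hN : IsMarkovChain μ (transition ρ) N) (k n : ℕ) :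
    MeasurableSet (survival N k n) := by
  have : survival N k n = {ω | N 0 ω = some n} ∩ ⋂ i ≤ k, {ω | N i ω ∈ ({none}ᶜ : Set State)} := by
    ext ω
    simp [survival]
  rw [this]
  exact (hN.measurableSet_eq _ _).inter
    (MeasurableSet.iInter fun i => MeasurableSet.iInter fun _ => hN.measurableSet_mem i _)

theorem measurableSet_stay (hN : IsMarkovChain μ (transition ρ) N) (k n m : ℕ) :
    MeasurableSet (stay N k n m) :=
  (measurableSet_survival hN k n).inter (hN.measurableSet_eq _ _)

theorem measurableSet_exit (hN : IsMarkovChain μ (transition ρ) N) (k n m : ℕ) :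
    MeasurableSet (exit N k n m) :=
  (measurableSet_stay hN k n m).inter (hN.measurableSet_eq _ _)

theorem ae_isPath [IsFiniteMeasure μ] (hN : IsMarkovChain μ (transition ρ) N) (hρ : 0 < ρ) :
    ∀ᵐ ω ∂μ, IsPath fun k => N k ω := by
  have h : ∀ᵐ ω ∂μ, ∀ (k : ℕ) (a b : State), transition ρ a b = 0 →
      ¬(N k ω = a ∧ N (k + 1) ω = b) := by
    simp only [ae_all_iff]
    intro k a b hab
    have h1 := hN.measureReal_step k (fun _ => True) (fun _ _ _ h => h)
      (transition_nonneg hρ a b)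
    simp only [true_and, hab, mul_zero] at h1
    rw [measureReal_eq_zero_iff] at h1
    rw [ae_iff]
    simpa using h1
  filter_upwards [h] with ω hω k
  constructor
  · intro hk
    change N (k + 1) ω = none
    rcases hb : N (k + 1) ω with _ | m
    · rfl
    · exact absurd ⟨hk, hb⟩ (hω k none (some m) rfl)
  · intro n hn
    change N (k + 1) ω = none ∨ N (k + 1) ω = some (n + 1) ∨ ∃ m, n = m + 1 ∧ N (k + 1) ω = some m
    rcases hb : N (k + 1) ω with _ | m
    · exact Or.inl rfl
    · refine Or.inr ?_
      by_cases h1 : m = n + 1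
      · exact Or.inl (by rw [h1])
      · by_cases h2 : n = m + 1
        · exact Or.inr ⟨m, h2, rfl⟩
        · exact absurd ⟨hn, hb⟩ (hω k (some n) (some m) (by simp [transition, h1, h2]))

theorem measureReal_stay_step [IsFiniteMeasure μ] (hN : IsMarkovChain μ (transition ρ) N)
    (hρ : 0 < ρ) (k n m : ℕ) (b : State) :
    μ.real (stay N k n m ∩ {ω | N (k + 1) ω = b})
      = μ.real (stay N k n m) * transition ρ (some m) b :=
  hN.measureReal_step k (fun x => x 0 = some n ∧ ∀ i ≤ k, x i ≠ none)
    (fun x y hxy h => ⟨by rw [← hxy 0 (Nat.zero_le k)]; exact h.1,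
      fun i hi => by rw [← hxy i hi]; exact h.2 i hi⟩) (transition_nonneg hρ _ _)

theorem measureReal_exit [IsFiniteMeasure μ] (hN : IsMarkovChain μ (transition ρ) N)
    (hρ : 0 < ρ) (k n m : ℕ) :
    μ.real (exit N k n m) = μ.real (stay N k n m) * (1 / (((m : ℝ) + 1) * (1 + ρ))) :=
  measureReal_stay_step hN hρ k n m none

/-- The forward equation of the killed chain. -/
theorem measureReal_stay_succ [IsFiniteMeasure μ] (hN : IsMarkovChain μ (transition ρ) N)
    (hρ : 0 < ρ) (k n m : ℕ) :
    μ.real (stay N (k + 1) n m) = μ.real (stay N k n (m + 1)) * ((m + 1) / ((m + 2) * (1 + ρ)))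
      + if m = 0 then 0 else μ.real (stay N k n (m - 1)) * (ρ / (1 + ρ)) := by
  have hdown : μ.real (stay N k n (m + 1) ∩ {ω | N (k + 1) ω = some m})
      = μ.real (stay N k n (m + 1)) * ((m + 1) / ((m + 2) * (1 + ρ))) := by
    rw [measureReal_stay_step hN hρ]
    simp only [transition]
    rw [if_neg (by omega), if_pos trivial]
    push_cast
    congr 3
    ring
  have hsplit (l : ℕ) {ω : Ω} (hω : ω ∈ stay N (k + 1) n m) (hl : N k ω = some l) :
      ω ∈ stay N k n l ∩ {ω | N (k + 1) ω = some m} :=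
    ⟨⟨⟨hω.1.1, fun i hi => hω.1.2 i (by omega)⟩, hl⟩, hω.2⟩
  have hsub (l : ℕ) {ω : Ω} (hω : ω ∈ stay N k n l ∩ {ω | N (k + 1) ω = some m}) :
      ω ∈ stay N (k + 1) n m := by
    refine ⟨⟨hω.1.1.1, fun i hi => ?_⟩, hω.2⟩
    rcases Nat.le_succ_iff.1 hi with hi | rfl
    · exact hω.1.1.2 i hi
    · rw [hω.2]
      simp
  rcases m with _ | m
  · rw [if_pos rfl, add_zero, ← hdown]
    refine measureReal_congr ?_
    filter_upwards [ae_isPath hN hρ] with ω hpath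
    refine propext ⟨fun hω => ?_, fun hω => hsub _ hω⟩
    rcases hk : N k ω with _ | l
    · exact absurd hk (hω.1.2 k (by omega))
    · have hnext := (hpath k).2 l hk
      simp only [show N (k + 1) ω = _ from hω.2] at hnext
      rcases hnext with h | h | ⟨l', rfl, h⟩ <;> simp at h
      subst h
      exact hsplit _ hω hk
  · have hup : μ.real (stay N k n m ∩ {ω | N (k + 1) ω = some (m + 1)})
        = μ.real (stay N k n m) * (ρ / (1 + ρ)) := by
      rw [measureReal_stay_step hN hρ]
      simp [transition]
    rw [if_neg (by omega), Nat.add_sub_cancel, ← hup, ← hdown, ← measureReal_union]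
    · refine measureReal_congr ?_
      filter_upwards [ae_isPath hN hρ] with ω hpath
      refine propext ⟨fun hω => ?_, fun hω => hω.elim (hsub _) (hsub _)⟩
      rcases hk : N k ω with _ | l
      · exact absurd hk (hω.1.2 k (by omega))
      · have hnext := (hpath k).2 l hk
        simp only [show N (k + 1) ω = _ from hω.2] at hnext
        rcases hnext with h | h | ⟨l', rfl, h⟩ <;> simp at h
        · subst h
          exact Or.inr (hsplit _ hω hk)
        · subst h
          exact Or.inl (hsplit _ hω hk)
    · refine Set.disjoint_left.2 fun ω h1 h2 => ?_
      have h := h1.1.2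
      rw [h2.1.2] at h
      simp at h
      omega
    · exact (measurableSet_stay hN _ _ _).inter (hN.measurableSet_eq _ _)

/-- The spectral representation of the killed chain. -/
theorem measureReal_stay [IsFiniteMeasure μ] (hN : IsMarkovChain μ (transition ρ) N)
    (hρ : 0 < ρ) (k n m : ℕ) :
    μ.real (stay N k n m)
      = μ.real {ω | N 0 ω = some n} * (((m : ℝ) + 1) * ρ ^ m * moment ρ k m n) := by
  induction k generalizing m with
  | zero =>
    rw [moment_zero hρ]
    split_ifs with hmn
    · subst hmn
      have : stay N 0 m m = {ω | N 0 ω = some m} := by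
        ext ω
        refine ⟨fun h => h.2, fun h => ⟨⟨h, fun i hi => ?_⟩, h⟩⟩
        rw [Nat.le_zero.1 hi, h]
        simp
      rw [this]
      field_simp
    · have : stay N 0 n m = ∅ := by
        refine Set.eq_empty_of_forall_notMem fun ω h => hmn ?_
        have h1 := h.2
        rw [h.1.1] at h1
        simpa using h1.symm
      rw [this]
      simp
  | succ k ih =>
    rw [measureReal_stay_succ hN hρ, ih, ih, moment_succ hρ]
    rcases m with _ | m
    · simp only [if_true, Nat.cast_zero, zero_div, zero_mul, add_zero]
      push_cast
      field_simp
      ring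
    · rw [if_neg (by omega)]
      simp only [Nat.add_sub_cancel]
      push_cast
      field_simp
      ring

end Chain

section Absorption

variable {Ω : Type*} [MeasurableSpace Ω] {μ : Measure Ω} {ρ : ℝ} {N : ℕ → Ω → State}

/-! ### Absorption -/

theorem measureReal_survival_le_sum [IsFiniteMeasure μ] (hN : IsMarkovChain μ (transition ρ) N)
    (hρ : 0 < ρ) (k n : ℕ) :
    μ.real (survival N k n) ≤ ∑ m ∈ Finset.range (n + k + 1), μ.real (stay N k n m) := by
  refine le_trans ?_ (measureReal_biUnion_finset_le _ _)
  refine ENNReal.toReal_mono (measure_ne_top _ _) (measure_mono_ae ?_)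
  filter_upwards [ae_isPath hN hρ] with ω hpath hω
  rcases hk : N k ω with _ | m
  · exact absurd hk (hω.2 k le_rfl)
  · have hle := hpath.le_add hω.1 k m hk
    exact Set.mem_biUnion (Finset.mem_coe.2 (Finset.mem_range.2 (Nat.lt_succ_of_le hle)))
      (show ω ∈ stay N k n m from ⟨hω, hk⟩)

/-- With at most `n + k` other customers, the next event is the departure of the tagged customer
with probability at least `1 / (2 (n + k + 1))`. -/
theorem measureReal_survival_succ_le [IsFiniteMeasure μ] (hN : IsMarkovChain μ (transition ρ) N)
    (hρ0 : 0 < ρ) (hρ1 : ρ < 1) (k n : ℕ) :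
    μ.real (survival N (k + 1) n)
      ≤ (1 - 1 / (2 * ((n : ℝ) + k + 1))) * μ.real (survival N k n) := by
  have hdisj : (↑(Finset.range (n + k + 1)) : Set ℕ).PairwiseDisjoint (exit N k n) := by
    intro m _ m' _ hmm
    exact Set.disjoint_left.2 fun ω h h' => hmm (exit_unique h h').2.2
  have h1 : μ.real (survival N (k + 1) n)
      + ∑ m ∈ Finset.range (n + k + 1), μ.real (exit N k n m) ≤ μ.real (survival N k n) := by
    rw [← measureReal_biUnion_finset hdisj fun m _ => measurableSet_exit hN k n m,
      ← measureReal_union _ (Finset.measurableSet_biUnion _ fun m _ => measurableSet_exit hN k n m)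
        (measure_ne_top _ _) (measure_ne_top _ _)]
    · refine measureReal_mono ?_
      rintro ω (hω | hω)
      · exact ⟨hω.1, fun i hi => hω.2 i (by omega)⟩
      · simp only [Set.mem_iUnion] at hω
        obtain ⟨m, -, hm⟩ := hω
        exact hm.1.1
    · refine Set.disjoint_left.2 fun ω hω hω' => ?_
      simp only [Set.mem_iUnion] at hω'
      obtain ⟨m, -, hm⟩ := hω'
      exact hω.2 (k + 1) le_rfl hm.2
  have h2 : 1 / (2 * ((n : ℝ) + k + 1)) * μ.real (survival N k n)
      ≤ ∑ m ∈ Finset.range (n + k + 1), μ.real (exit N k n m) := by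
    refine (mul_le_mul_of_nonneg_left (measureReal_survival_le_sum hN hρ0 k n)
      (by positivity)).trans ?_
    rw [Finset.mul_sum]
    refine Finset.sum_le_sum fun m hm => ?_
    rw [measureReal_exit hN hρ0, mul_comm]
    refine mul_le_mul_of_nonneg_left ?_ measureReal_nonneg
    have hm' : (m : ℝ) ≤ n + k := by
      have := Finset.mem_range.1 hm
      exact_mod_cast (by omega : m ≤ n + k)
    refine one_div_le_one_div_of_le (by positivity) ?_
    nlinarith [(Nat.cast_nonneg m : (0 : ℝ) ≤ m)]
  linarith

/-- The survival probability `s_k` after `k` events is of order `k^{-1/2}` at most: by the bound on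
one step, `s_k ^ 2 * (n + k + 1)` does not increase. -/
theorem sq_measureReal_survival_le [IsFiniteMeasure μ] (hN : IsMarkovChain μ (transition ρ) N)
    (hρ0 : 0 < ρ) (hρ1 : ρ < 1) (k n : ℕ) :
    μ.real (survival N k n) ^ 2 * ((n : ℝ) + k + 1)
      ≤ μ.real (survival N 0 n) ^ 2 * ((n : ℝ) + 1) := by
  induction k with
  | zero => simp
  | succ k ih =>
    refine le_trans ?_ ih
    have h := measureReal_survival_succ_le hN hρ0 hρ1 k n
    set s := μ.real (survival N k n)
    have hi : (1 : ℝ) ≤ (n : ℝ) + k + 1 := by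
      have : (0 : ℝ) ≤ (n : ℝ) + k := by positivity
      linarith
    push_cast
    rw [← add_assoc]
    set i : ℝ := (n : ℝ) + k + 1
    have h1 : (1 - 1 / (2 * i)) ^ 2 * (i + 1) ≤ i := by
      have : (1 - 1 / (2 * i)) ^ 2 * (i + 1) = i - (3 * i - 1) / (4 * i ^ 2) := by
        field_simp
        ring
      rw [this, sub_le_self_iff]
      exact div_nonneg (by linarith) (by positivity)
    calc μ.real (survival N (k + 1) n) ^ 2 * (i + 1)
        ≤ ((1 - 1 / (2 * i)) * s) ^ 2 * (i + 1) := by gcongr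
      _ = s ^ 2 * ((1 - 1 / (2 * i)) ^ 2 * (i + 1)) := by ring
      _ ≤ s ^ 2 * i := by gcongr

theorem measureReal_forall_survival [IsFiniteMeasure μ] (hN : IsMarkovChain μ (transition ρ) N)
    (hρ0 : 0 < ρ) (hρ1 : ρ < 1) (n : ℕ) :
    μ.real {ω | N 0 ω = some n ∧ ∀ i, N i ω ≠ none} = 0 := by
  set s := μ.real {ω | N 0 ω = some n ∧ ∀ i, N i ω ≠ none}
  have hs : 0 ≤ s := measureReal_nonneg
  by_contra hne
  have hpos : 0 < s ^ 2 := pow_pos (lt_of_le_of_ne hs (Ne.symm hne)) 2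
  obtain ⟨k, hk⟩ := exists_nat_gt (μ.real (survival N 0 n) ^ 2 * ((n : ℝ) + 1) / s ^ 2)
  rw [div_lt_iff₀ hpos] at hk
  have h1 := sq_measureReal_survival_le hN hρ0 hρ1 k n
  have h2 : s ≤ μ.real (survival N k n) :=
    measureReal_mono fun ω hω => ⟨hω.1, fun i _ => hω.2 i⟩
  have h3 : s ^ 2 * k ≤ μ.real (survival N k n) ^ 2 * ((n : ℝ) + k + 1) := by
    have : (k : ℝ) ≤ (n : ℝ) + k + 1 := by
      have : (0 : ℝ) ≤ n := Nat.cast_nonneg n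
      linarith
    gcongr
  linarith

theorem ae_initial_ne_none [IsProbabilityMeasure μ] (hN : IsMarkovChain μ (transition ρ) N)
    (hstat : IsStationaryQueueLength ρ fun n => μ.real {ω | N 0 ω = some n}) :
    ∀ᵐ ω ∂μ, N 0 ω ≠ none := by
  have hcompl : {ω | N 0 ω ≠ none} = ⋃ n : ℕ, {ω | N 0 ω = some n} := by
    ext ω
    simp [Option.ne_none_iff_exists']
  have h1 : μ {ω | N 0 ω ≠ none} = 1 := by
    rw [hcompl, measure_iUnion (fun n m hnm => Set.disjoint_left.2 fun ω h h' => hnm ?_)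
      fun n => hN.measurableSet_eq 0 _]
    · have h2 := ENNReal.ofReal_tsum_of_nonneg hstat.nonneg hstat.hasSum_one.summable
      rw [hstat.hasSum_one.tsum_eq, ENNReal.ofReal_one] at h2
      rw [h2]
      exact tsum_congr fun n => (ofReal_measureReal).symm
    · have h3 : some n = some m := h.symm.trans h'
      simpa using h3
  have hm : MeasurableSet {ω | N 0 ω ≠ none} := by
    rw [hcompl]
    exact MeasurableSet.iUnion fun n => hN.measurableSet_eq 0 _
  exact (mem_ae_iff_prob_eq_one hm).2 h1

theorem ae_exists_exit [IsProbabilityMeasure μ] (hN : IsMarkovChain μ (transition ρ) N)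
    (hρ0 : 0 < ρ) (hρ1 : ρ < 1)
    (hstat : IsStationaryQueueLength ρ fun n => μ.real {ω | N 0 ω = some n}) :
    ∀ᵐ ω ∂μ, ∃ k n m, ω ∈ exit N k n m := by
  have h : ∀ᵐ ω ∂μ, ∀ n, ¬(N 0 ω = some n ∧ ∀ i, N i ω ≠ none) := by
    rw [ae_all_iff]
    intro n
    have h1 := measureReal_forall_survival hN hρ0 hρ1 n
    rw [measureReal_eq_zero_iff] at h1
    rw [ae_iff]
    simpa only [not_not] using h1
  filter_upwards [h, ae_initial_ne_none hN hstat] with ω hω h0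
  obtain ⟨n, hn⟩ := Option.ne_none_iff_exists'.1 h0
  have hex : ∃ i, N i ω = none := by
    by_contra hcon
    exact hω n ⟨hn, fun i hi => hcon ⟨i, hi⟩⟩
  classical
  obtain ⟨k, hk⟩ : ∃ k, Nat.find hex = k + 1 := by
    refine Nat.exists_eq_succ_of_ne_zero fun hz => h0 ?_
    rw [← hz]
    exact Nat.find_spec hex
  have hne : ∀ i ≤ k, N i ω ≠ none := fun i hi => Nat.find_min hex (by omega)
  obtain ⟨m, hm⟩ := Option.ne_none_iff_exists'.1 (hne k le_rfl)
  refine ⟨k, n, m, ⟨⟨hn, hne⟩, hm⟩, ?_⟩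
  rw [← hk]
  exact Nat.find_spec hex

/-! ### The laws of the numbers of arrivals and departures -/

theorem measureReal_exit_eq [IsFiniteMeasure μ] (hN : IsMarkovChain μ (transition ρ) N)
    (hρ0 : 0 < ρ) (hρ1 : ρ < 1)
    (hstat : IsStationaryQueueLength ρ fun n => μ.real {ω | N 0 ω = some n}) (k n m : ℕ) :
    μ.real (exit N k n m) = (1 - ρ) / (1 + ρ) * (ρ ^ (m + n) * moment ρ k m n) := by
  rw [measureReal_exit hN hρ0, measureReal_stay hN hρ0, hstat.eq_geometric hρ0 hρ1, pow_add]
  field_simp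

theorem measure_exit_comm [IsFiniteMeasure μ] (hN : IsMarkovChain μ (transition ρ) N)
    (hρ0 : 0 < ρ) (hρ1 : ρ < 1)
    (hstat : IsStationaryQueueLength ρ fun n => μ.real {ω | N 0 ω = some n}) (k n m : ℕ) :
    μ (exit N k n m) = μ (exit N k m n) := by
  rw [← ofReal_measureReal, ← ofReal_measureReal, measureReal_exit_eq hN hρ0 hρ1 hstat,
    measureReal_exit_eq hN hρ0 hρ1 hstat, moment_comm, add_comm m n]

/-- Almost surely, the numbers of arrivals and of departures are the ones dictated by the initial
and final numbers of customers and by the length of the sojourn. -/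
theorem ae_exit_counts [IsProbabilityMeasure μ] (hN : IsMarkovChain μ (transition ρ) N)
    (hρ0 : 0 < ρ) (hρ1 : ρ < 1)
    (hstat : IsStationaryQueueLength ρ fun n => μ.real {ω | N 0 ω = some n}) :
    ∀ᵐ ω ∂μ, ∃ k n m a d : ℕ, ω ∈ exit N k n m ∧ arrivals (fun k => N k ω) = a ∧
      departures (fun k => N k ω) = d ∧ a + d = k ∧ n + a = m + d := by
  filter_upwards [ae_exists_exit hN hρ0 hρ1 hstat, ae_isPath hN hρ0] with ω ⟨k, n, m, hω⟩ hpath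
  obtain ⟨a, d, h⟩ := hpath.exists_arrivals_departures hω.1.1.1 hω.1.1.2 hω.1.2 hω.2
  exact ⟨k, n, m, a, d, hω, h⟩

/-- Exit with parameters tied together by the number `j` of arrivals; empty if more than `n + j`
customers are left behind. -/
def exitArrivals (N : ℕ → Ω → State) (j : ℕ) (p : ℕ × ℕ) : Set Ω :=
  {ω | p.2 ≤ p.1 + j ∧ ω ∈ exit N (2 * j + p.1 - p.2) p.1 p.2}

/-- Exit with parameters tied together by the number `j` of departures. -/
def exitDepartures (N : ℕ → Ω → State) (j : ℕ) (p : ℕ × ℕ) : Set Ω :=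
  {ω | p.1 ≤ p.2 + j ∧ ω ∈ exit N (2 * j + p.2 - p.1) p.1 p.2}

theorem measure_arrivals_eq [IsProbabilityMeasure μ] (hN : IsMarkovChain μ (transition ρ) N)
    (hρ0 : 0 < ρ) (hρ1 : ρ < 1)
    (hstat : IsStationaryQueueLength ρ fun n => μ.real {ω | N 0 ω = some n}) (j : ℕ) :
    μ {ω | arrivals (fun k => N k ω) = (j : ℕ∞)} = ∑' p : ℕ × ℕ, μ (exitArrivals N j p) := by
  have hae : {ω | arrivals (fun k => N k ω) = (j : ℕ∞)} =ᵐ[μ] ⋃ p, exitArrivals N j p := by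
    filter_upwards [ae_exit_counts hN hρ0 hρ1 hstat] with ω ⟨k, n, m, a, d, hω, ha, hd, h1, h2⟩
    refine propext ⟨fun h => ?_, fun h => ?_⟩
    · have h' : (a : ℕ∞) = j := ha.symm.trans h
      have haj : a = j := by exact_mod_cast h'
      refine Set.mem_iUnion.2 ⟨(n, m), by simp only; omega, ?_⟩
      rwa [show 2 * j + n - m = k by omega]
    · obtain ⟨⟨n', m'⟩, hle, hω'⟩ := Set.mem_iUnion.1 h
      obtain ⟨e1, e2, e3⟩ := exit_unique hω hω'
      simp only at hle e1 e2 e3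
      change arrivals (fun k => N k ω) = (j : ℕ∞)
      rw [ha, show a = j by omega]
  rw [measure_congr hae, measure_iUnion]
  · intro p q hpq
    refine Set.disjoint_left.2 fun ω h h' => hpq ?_
    obtain ⟨-, e2, e3⟩ := exit_unique h.2 h'.2
    exact Prod.ext e2 e3
  · exact fun p => (MeasurableSet.const _).inter (measurableSet_exit hN _ _ _)

theorem measure_departures_eq [IsProbabilityMeasure μ] (hN : IsMarkovChain μ (transition ρ) N)
    (hρ0 : 0 < ρ) (hρ1 : ρ < 1)
    (hstat : IsStationaryQueueLength ρ fun n => μ.real {ω | N 0 ω = some n}) (j : ℕ) :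
    μ {ω | departures (fun k => N k ω) = (j : ℕ∞)} = ∑' p : ℕ × ℕ, μ (exitDepartures N j p) := by
  have hae : {ω | departures (fun k => N k ω) = (j : ℕ∞)} =ᵐ[μ] ⋃ p, exitDepartures N j p := by
    filter_upwards [ae_exit_counts hN hρ0 hρ1 hstat] with ω ⟨k, n, m, a, d, hω, ha, hd, h1, h2⟩
    refine propext ⟨fun h => ?_, fun h => ?_⟩
    · have h' : (d : ℕ∞) = j := hd.symm.trans h
      have hdj : d = j := by exact_mod_cast h'
      refine Set.mem_iUnion.2 ⟨(n, m), by simp only; omega, ?_⟩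
      rwa [show 2 * j + m - n = k by omega]
    · obtain ⟨⟨n', m'⟩, hle, hω'⟩ := Set.mem_iUnion.1 h
      obtain ⟨e1, e2, e3⟩ := exit_unique hω hω'
      simp only at hle e1 e2 e3
      change departures (fun k => N k ω) = (j : ℕ∞)
      rw [hd, show d = j by omega]
  rw [measure_congr hae, measure_iUnion]
  · intro p q hpq
    refine Set.disjoint_left.2 fun ω h h' => hpq ?_
    obtain ⟨-, e2, e3⟩ := exit_unique h.2 h'.2
    exact Prod.ext e2 e3
  · exact fun p => (MeasurableSet.const _).inter (measurableSet_exit hN _ _ _)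

/-- The killed chain started from its stationary law is reversible: exchanging the numbers of
customers found and left behind exchanges arrivals and departures. -/
theorem measure_arrivals_eq_departures [IsProbabilityMeasure μ]
    (hN : IsMarkovChain μ (transition ρ) N) (hρ0 : 0 < ρ) (hρ1 : ρ < 1)
    (hstat : IsStationaryQueueLength ρ fun n => μ.real {ω | N 0 ω = some n}) (j : ℕ) :
    μ {ω | arrivals (fun k => N k ω) = (j : ℕ∞)}
      = μ {ω | departures (fun k => N k ω) = (j : ℕ∞)} := by
  rw [measure_arrivals_eq hN hρ0 hρ1 hstat, measure_departures_eq hN hρ0 hρ1 hstat,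
    ← (Equiv.prodComm ℕ ℕ).tsum_eq]
  refine tsum_congr fun ⟨n, m⟩ => ?_
  by_cases h : n ≤ m + j
  · have e1 : exitArrivals N j (m, n) = exit N (2 * j + m - n) m n := by
      simp [exitArrivals, h]
    have e2 : exitDepartures N j (n, m) = exit N (2 * j + m - n) n m := by
      simp [exitDepartures, h]
    rw [Equiv.prodComm_apply, Prod.swap_prod_mk, e1, e2, measure_exit_comm hN hρ0 hρ1 hstat]
  · simp [exitArrivals, exitDepartures, h]

theorem hasSum_measureReal_arrivals [IsProbabilityMeasure μ]
    (hN : IsMarkovChain μ (transition ρ) N) (hρ0 : 0 < ρ) (hρ1 : ρ < 1)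
    (hstat : IsStationaryQueueLength ρ fun n => μ.real {ω | N 0 ω = some n}) (j : ℕ) :
    HasSum (fun n : ℕ => (1 - ρ) / (1 + ρ) * ∑ m ∈ Finset.range (j + n + 1),
        ρ ^ (m + n) * moment ρ (2 * j + n - m) m n)
      (μ.real {ω | arrivals (fun k => N k ω) = (j : ℕ∞)}) := by
  have h := measure_arrivals_eq hN hρ0 hρ1 hstat j
  rw [ENNReal.tsum_prod'] at h
  have hinner (n : ℕ) : (∑' m, μ (exitArrivals N j (n, m))).toReal
      = (1 - ρ) / (1 + ρ) * ∑ m ∈ Finset.range (j + n + 1),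
        ρ ^ (m + n) * moment ρ (2 * j + n - m) m n := by
    rw [tsum_eq_sum (s := Finset.range (j + n + 1)), ENNReal.toReal_sum
      fun _ _ => measure_ne_top _ _, Finset.mul_sum]
    · refine Finset.sum_congr rfl fun m hm => ?_
      have hle : m ≤ n + j := by
        have := Finset.mem_range.1 hm
        omega
      have : exitArrivals N j (n, m) = exit N (2 * j + n - m) n m := by
        simp [exitArrivals, hle]
      rw [this, ← measureReal_def, measureReal_exit_eq hN hρ0 hρ1 hstat]
    · intro m hm
      have hle : ¬m ≤ n + j := by
        have := Finset.mem_range.not.1 hm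
        omega
      simp [exitArrivals, hle]
  have hne : ∑' n, ∑' m, μ (exitArrivals N j (n, m)) ≠ ⊤ := by
    rw [← h]
    exact measure_ne_top _ _
  have hsum := ENNReal.hasSum_toReal hne
  rw [← ENNReal.tsum_toReal_eq fun n => ENNReal.ne_top_of_tsum_ne_top hne n, ← h,
    ← measureReal_def] at hsum
  simpa only [hinner] using hsum

theorem measurable_arrivals (hN : IsMarkovChain μ (transition ρ) N) :
    Measurable fun ω => arrivals fun k => N k ω := by
  refine measurable_encard.comp (measurable_set_iff.2 fun k => measurableSet_setOfPred.1 ?_)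
  have : {ω | (∀ i ≤ k, N i ω ≠ none) ∧ ∃ n : ℕ, N k ω = some n ∧ N (k + 1) ω = some (n + 1)}
      = (⋂ i ≤ k, {ω | N i ω ∈ ({none}ᶜ : Set State)})
        ∩ ⋃ n : ℕ, {ω | N k ω = some n} ∩ {ω | N (k + 1) ω = some (n + 1)} := by
    ext ω
    simp
  exact this ▸ (MeasurableSet.iInter fun i => MeasurableSet.iInter fun _ =>
    hN.measurableSet_mem i _).inter (MeasurableSet.iUnion fun n =>
      (hN.measurableSet_eq _ _).inter (hN.measurableSet_eq _ _))

theorem measurable_departures (hN : IsMarkovChain μ (transition ρ) N) :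
    Measurable fun ω => departures fun k => N k ω := by
  refine measurable_encard.comp (measurable_set_iff.2 fun k => measurableSet_setOfPred.1 ?_)
  have : {ω | (∀ i ≤ k, N i ω ≠ none) ∧ ∃ n : ℕ, N k ω = some (n + 1) ∧ N (k + 1) ω = some n}
      = (⋂ i ≤ k, {ω | N i ω ∈ ({none}ᶜ : Set State)})
        ∩ ⋃ n : ℕ, {ω | N k ω = some (n + 1)} ∩ {ω | N (k + 1) ω = some n} := by
    ext ω
    simp
  exact this ▸ (MeasurableSet.iInter fun i => MeasurableSet.iInter fun _ =>
    hN.measurableSet_mem i _).inter (MeasurableSet.iUnion fun n =>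
      (hN.measurableSet_eq _ _).inter (hN.measurableSet_eq _ _))

end Absorption

end PSQueue

theorem mainTheorem1 {Ω : Type*} [MeasurableSpace Ω] (μ : Measure Ω) [IsProbabilityMeasure μ]
    (ρ : ℝ) (hρ0 : 0 < ρ) (hρ1 : ρ < 1)
    (N : ℕ → Ω → PSQueue.State)
    (hN : PSQueue.IsMarkovChain μ (PSQueue.transition ρ) N)
    (hstat : PSQueue.IsStationaryQueueLength ρ (fun n => μ.real {ω | N 0 ω = some n})) :
    (∀ᵐ ω ∂μ, PSQueue.arrivals (fun k => N k ω) ≠ ⊤) ∧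
    (∀ k m n : ℕ,
      Integrable (fun x : ℝ => x ^ k * PSQueue.Q ρ m x * PSQueue.Q ρ n x) (PSQueue.psi ρ)) ∧
    (∀ j : ℕ,
      HasSum
        (fun n : ℕ => (1 - ρ) / (1 + ρ) * ∑ m ∈ Finset.range (j + n + 1), ρ ^ (m + n) *
          ∫ x, x ^ (2 * j + n - m) * PSQueue.Q ρ m x * PSQueue.Q ρ n x ∂(PSQueue.psi ρ))
        (μ.real {ω | PSQueue.arrivals (fun k => N k ω) = (j : ℕ∞)})) ∧
    IdentDistrib (fun ω => PSQueue.arrivals (fun k => N k ω))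
      (fun ω => PSQueue.departures (fun k => N k ω)) μ μ := by
  have hcounts := PSQueue.ae_exit_counts hN hρ0 hρ1 hstat
  have harr : ∀ᵐ ω ∂μ, PSQueue.arrivals (fun k => N k ω) ≠ ⊤ := by
    filter_upwards [hcounts] with ω ⟨_, _, _, a, _, _, ha, _⟩
    rw [ha]
    exact ENat.natCast_ne_top a
  have hdep : ∀ᵐ ω ∂μ, PSQueue.departures (fun k => N k ω) ≠ ⊤ := by
    filter_upwards [hcounts] with ω ⟨_, _, _, _, d, _, _, hd, _⟩
    rw [hd]
    exact ENat.natCast_ne_top d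
  have hma := PSQueue.measurable_arrivals hN
  have hmd := PSQueue.measurable_departures hN
  refine ⟨harr, PSQueue.integrable_pow_mul_Q_mul_Q ρ,
    PSQueue.hasSum_measureReal_arrivals hN hρ0 hρ1 hstat, hma.aemeasurable, hmd.aemeasurable,
    Measure.ext_of_singleton fun j => ?_⟩
  rw [Measure.map_apply hma (measurableSet_singleton j),
    Measure.map_apply hmd (measurableSet_singleton j)]
  induction j using ENat.recTopCoe with
  | top =>
    have h1 : μ {ω | PSQueue.arrivals (fun k => N k ω) = ⊤} = 0 := by
      simpa only [ae_iff, not_not] using harr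
    have h2 : μ {ω | PSQueue.departures (fun k => N k ω) = ⊤} = 0 := by
      simpa only [ae_iff, not_not] using hdep
    exact h1.trans h2.symm
  | coe j => exact PSQueue.measure_arrivals_eq_departures hN hρ0 hρ1 hstat j
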